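/- Let $\Bbbk$ be an algebraically closed field of characteristic zero, let $t,a,b,p,q,k\in\Bbbk$, and let $V$ be the $3$-dimensional vector space with basis $x_1,x_2,x_3$ and the braiding $c$ of type $\mathfrak R_{1,2}$ (writing $x_ix_j$ for $x_i\otimes x_j\in V\otimes V$): \begin{align*} c(x_1x_1)&=t\,x_1x_1, & c(x_2x_1)&=t\,x_1x_2, & c(x_3x_1)&=t(x_1x_3+b\,x_1x_1),\\ c(x_1x_2)&=t\,x_2x_1, & c(x_2x_2)&=t\,x_2x_2, & c(x_3x_2)&=t(x_2x_3+b\,x_2x_1+(p-q)\,x_1x_2),\\ c(x_1x_3)&=t(x_3x_1+p\,x_1x_1), & c(x_2x_3)&=t(x_3x_2+q\,x_1x_2), && \end{align*} $$c(x_3x_3)=t\,(x_3x_3+b\,x_3x_1-k\,x_2x_1+p\,x_1x_3+k\,x_1x_2+a\,x_1x_1).$$ Let $T(V)$ be the tensor algebra with its braided Hopf algebra structure in which the elements of $V$ are primitive, let $\mathcal J(V)$ be the largest homogeneous Hopf ideal of $T(V)$ generated by homogeneous elements of degree $\ge 2$, and let $\mathfrak B(V)=T(V)/\mathcal J(V)$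 be the Nichols algebra of $(V,c)$. (a) If $t=1$ and $b=p-2q$, then $$\mathcal J(V)=\langle x_2x_1-x_1x_2,\ x_3x_1-x_1x_3+q\,x_1^2,\ x_3x_2-x_2x_3+(2q-p)\,x_1x_2\rangle,$$ $B_3=\{x_1^{a_1}x_2^{a_2}x_3^{a_3}: a_i\ge 0\}$ is a basis of $\mathfrak B(V)$, and $\operatorname{GKdim}\mathfrak B(V)=3$. (b) If $t=-1$, $b=-p$ and $a\ne -p^2$, then $$\mathcal J(V)=\langle x_2x_1+x_1x_2,\ x_3x_1+x_1x_3,\ x_3x_2+x_2x_3+p\,x_1x_2,\ x_1^2,\ x_2^2\rangle,$$ $B_1=\{x_1^{a_1}x_2^{a_2}x_3^{a_3}: a_i\ge 0,\ a_1,a_2<2\}$ is a basis of $\mathfrak B(V)$, and $\operatorname{GKdim}\mathfrak B(V)=1$. (c) If $t=-1$, $b=-p$ and $a=-p^2$, then $$\mathcal J(V)=\langle x_2x_1+x_1x_2,\ x_3x_1+x_1x_3,\ x_3x_2+x_2x_3+p\,x_1x_2,\ x_1^2,\ x_2^2,\ x_3^2+k\,x_1x_2+p\,x_1x_3\rangle,$$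 $B_0=\{x_1^{a_1}x_2^{a_2}x_3^{a_3}: 0\le a_i<2\}$ is a basis of $\mathfrak B(V)$, $\operatorname{GKdim}\mathfrak B(V)=0$ and $\dim\mathfrak B(V)=8$. -/

import Mathlib

open scoped TensorProduct

noncomputable section

namespace Nichols

section General

/-! A finite-dimensional braided vector space `V` with basis `(x_i)_{i : ι}` is given by the
structure constants of its braiding, `c (x_i ⊗ x_j) = ∑ k l, r i j k l • x_k ⊗ x_l`.
Its tensor algebra `T(V)` is the free algebra on the `x_i`. -/

variable {𝕜 : Type*} [Field 𝕜] {ι : Type*} [Fintype ι] [DecidableEq ι]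

/-- The braiding `V ⊗ T(V) → T(V) ⊗ V` induced by `c`, in matrix form:
`c (x_i ⊗ y) = ∑ l, (braidMatrix r y) i l ⊗ x_l`. Compatibility with the multiplication,
`c (id ⊗ m) = (m ⊗ id) (id ⊗ c) (c ⊗ id)`, says that `braidMatrix r` is multiplicative. -/
def braidMatrix (r : ι → ι → ι → ι → 𝕜) :
    FreeAlgebra 𝕜 ι →ₐ[𝕜] Matrix ι ι (FreeAlgebra 𝕜 ι) :=
  FreeAlgebra.lift 𝕜 fun j => Matrix.of fun i l => ∑ k, r i j k l • FreeAlgebra.ι 𝕜 k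

/-- `braidLeft r i l` is the linear map `y ↦ (braidMatrix r y) i l`. -/
def braidLeft (r : ι → ι → ι → ι → 𝕜) (i l : ι) : FreeAlgebra 𝕜 ι →ₗ[𝕜] FreeAlgebra 𝕜 ι :=
  Matrix.entryLinearMap 𝕜 (FreeAlgebra 𝕜 ι) i l ∘ₗ (braidMatrix r).toLinearMap

/-- Left multiplication by `x_i ⊗ 1 + 1 ⊗ x_i` in the braided tensor product algebra
`T(V) ⊗ T(V)`, whose product is `(m ⊗ m) (id ⊗ c ⊗ id)`:
`y ⊗ z ↦ x_i y ⊗ z + ∑ l, (braidMatrix r y) i l ⊗ x_l z`. -/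
def comulStep (r : ι → ι → ι → ι → 𝕜) (i : ι) :
    Module.End 𝕜 (FreeAlgebra 𝕜 ι ⊗[𝕜] FreeAlgebra 𝕜 ι) :=
  TensorProduct.map (LinearMap.mulLeft 𝕜 (FreeAlgebra.ι 𝕜 i)) LinearMap.id +
    ∑ l, TensorProduct.map (braidLeft r i l) (LinearMap.mulLeft 𝕜 (FreeAlgebra.ι 𝕜 l))

/-- The comultiplication of the braided Hopf algebra `T(V)`: the algebra map to the braided
tensor product `T(V) ⊗ T(V)` for which every `x_i` is primitive. -/
def comul (r : ι → ι → ι → ι → 𝕜) (x : FreeAlgebra 𝕜 ι) :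
    FreeAlgebra 𝕜 ι ⊗[𝕜] FreeAlgebra 𝕜 ι :=
  FreeAlgebra.lift 𝕜 (comulStep r) x (1 ⊗ₜ[𝕜] 1)

/-- The map `y ↦ - m (c (x_i ⊗ y))`. -/
def antipodeStep (r : ι → ι → ι → ι → 𝕜) (i : ι) : Module.End 𝕜 (FreeAlgebra 𝕜 ι) :=
  -∑ l, LinearMap.mulRight 𝕜 (FreeAlgebra.ι 𝕜 l) ∘ₗ braidLeft r i l

/-- The antipode `S` of the braided Hopf algebra `T(V)`: it satisfies `S x_i = - x_i` and
`S ∘ m = m ∘ c ∘ (S ⊗ S)`, that is, `S 1 = 1` and `S (x_i y) = - m (c (x_i ⊗ S y))`. -/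
def antipode (r : ι → ι → ι → ι → 𝕜) (x : FreeAlgebra 𝕜 ι) : FreeAlgebra 𝕜 ι :=
  FreeAlgebra.lift 𝕜 (antipodeStep r) x 1

/-- The homogeneous component `T^n(V)`. -/
def degreePart (𝕜 : Type*) [Field 𝕜] (ι : Type*) (n : ℕ) : Submodule 𝕜 (FreeAlgebra 𝕜 ι) :=
  Submodule.span 𝕜 (Set.range (FreeAlgebra.ι 𝕜 (X := ι))) ^ n

/-- Homogeneous Hopf ideals of `T(V)` generated by homogeneous elements of degree at least `2`. -/
structure IsHomogeneousHopfIdeal (r : ι → ι → ι → ι → 𝕜)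
    (I : TwoSidedIdeal (FreeAlgebra 𝕜 ι)) : Prop where
  generated : ∃ s : Set (FreeAlgebra 𝕜 ι),
    (∀ x ∈ s, ∃ n, 2 ≤ n ∧ x ∈ degreePart 𝕜 ι n) ∧ I = TwoSidedIdeal.span s
  /-- `Δ(I) ⊆ I ⊗ T(V) + T(V) ⊗ I` -/
  comul_mem : ∀ x ∈ I, comul r x ∈
    Submodule.span 𝕜 {z | ∃ u v : FreeAlgebra 𝕜 ι, (u ∈ I ∨ v ∈ I) ∧ z = u ⊗ₜ[𝕜] v}
  counit_eq_zero : ∀ x ∈ I, FreeAlgebra.algebraMapInv x = 0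
  antipode_mem : ∀ x ∈ I, antipode r x ∈ I

/-- The ideal `J(V)` of relations of the Nichols algebra: the largest (i.e. the sum of all)
homogeneous Hopf ideal of `T(V)` generated by homogeneous elements of degree at least `2`. -/
def nicholsIdeal (r : ι → ι → ι → ι → 𝕜) : TwoSidedIdeal (FreeAlgebra 𝕜 ι) :=
  sSup {I | IsHomogeneousHopfIdeal r I}

/-- The Nichols algebra `B(V) = T(V) / J(V)`. -/
abbrev NicholsAlgebra (r : ι → ι → ι → ι → 𝕜) : Type _ :=
  (nicholsIdeal r).ringCon.Quotient

/-- The image of the basis vector `x_i` of `V` in `B(V)`. -/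
def gen (r : ι → ι → ι → ι → 𝕜) (i : ι) : NicholsAlgebra r :=
  (nicholsIdeal r).ringCon.mk' (FreeAlgebra.ι 𝕜 i)

end General

/-- The Gelfand-Kirillov dimension of an algebra: the supremum over the finite-dimensional
subspaces `W` of `limsup_n log (dim (W^0 + W^1 + ⋯ + W^n)) / log n`. -/
def gkDim (𝕜 A : Type*) [Field 𝕜] [Ring A] [Algebra 𝕜 A] : EReal :=
  ⨆ (W : Submodule 𝕜 A) (_ : W.FG),
    Filter.limsup (fun n : ℕ =>
      ((Real.log (Module.finrank 𝕜 (⨆ i ∈ Finset.range (n + 1), W ^ i : Submodule 𝕜 A)) /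
        Real.log n : ℝ) : EReal)) Filter.atTop

section RankThree

variable {𝕜 : Type*} [Field 𝕜]

/-- The `R`-matrix of type `(1, 2)`. Rows are indexed by the pairs `kl` in the order
`11, 12, 13, 21, 22, 23, 31, 32, 33`, columns by the pairs `ij` in the order
`11, 21, 31, 12, 22, 32, 13, 23, 33`. -/
def R12 (t a b p q k : 𝕜) : Matrix (Fin 9) (Fin 9) 𝕜 :=
  !![t, 0, t * b, 0, 0, 0,           t * p, 0,     t * a;
     0, t, 0,     0, 0, t * (p - q), 0,     t * q, t * k;
     0, 0, t,     0, 0, 0,           0,     0,     t * p;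
     0, 0, 0,     t, 0, t * b,       0,     0,     -(t * k);
     0, 0, 0,     0, t, 0,           0,     0,     0;
     0, 0, 0,     0, 0, t,           0,     0,     0;
     0, 0, 0,     0, 0, 0,           t,     0,     t * b;
     0, 0, 0,     0, 0, 0,           0,     t,     0;
     0, 0, 0,     0, 0, 0,           0,     0,     t]

/-- The structure constants of the braiding `c (x_i ⊗ x_j) = ∑ k l, r^{ij}_{kl} x_k ⊗ x_l`
associated with the `R`-matrix; `finProdFinEquiv (k, l) = 3 * k + l` for `k l : Fin 3`. The
basis vectors `x_1, x_2, x_3` have the indices `0, 1, 2`. -/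
def c12 (t a b p q k : 𝕜) (i j m l : Fin 3) : 𝕜 :=
  R12 t a b p q k (finProdFinEquiv (m, l)) (finProdFinEquiv (j, i))

/-- The generator `x_{i+1}` of the tensor algebra. -/
abbrev x (𝕜 : Type*) [Field 𝕜] (i : Fin 3) : FreeAlgebra 𝕜 (Fin 3) := FreeAlgebra.ι 𝕜 i

/-- Relations for `t = 1`, `b = p - 2q`. -/
def relA (p q : 𝕜) : Set (FreeAlgebra 𝕜 (Fin 3)) :=
  {x 𝕜 1 * x 𝕜 0 - x 𝕜 0 * x 𝕜 1,
   x 𝕜 2 * x 𝕜 0 - x 𝕜 0 * x 𝕜 2 + q • x 𝕜 0 ^ 2,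
   x 𝕜 2 * x 𝕜 1 - x 𝕜 1 * x 𝕜 2 + (2 * q - p) • (x 𝕜 0 * x 𝕜 1)}

/-- Relations for `t = -1`, `b = -p`, `a ≠ -p²`. -/
def relB (p : 𝕜) : Set (FreeAlgebra 𝕜 (Fin 3)) :=
  {x 𝕜 1 * x 𝕜 0 + x 𝕜 0 * x 𝕜 1,
   x 𝕜 2 * x 𝕜 0 + x 𝕜 0 * x 𝕜 2,
   x 𝕜 2 * x 𝕜 1 + x 𝕜 1 * x 𝕜 2 + p • (x 𝕜 0 * x 𝕜 1),
   x 𝕜 0 ^ 2,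
   x 𝕜 1 ^ 2}

/-- Relations for `t = -1`, `b = -p`, `a = -p²`. -/
def relC (p k : 𝕜) : Set (FreeAlgebra 𝕜 (Fin 3)) :=
  {x 𝕜 1 * x 𝕜 0 + x 𝕜 0 * x 𝕜 1,
   x 𝕜 2 * x 𝕜 0 + x 𝕜 0 * x 𝕜 2,
   x 𝕜 2 * x 𝕜 1 + x 𝕜 1 * x 𝕜 2 + p • (x 𝕜 0 * x 𝕜 1),
   x 𝕜 0 ^ 2,
   x 𝕜 1 ^ 2,
   x 𝕜 2 ^ 2 + k • (x 𝕜 0 * x 𝕜 1) + p • (x 𝕜 0 * x 𝕜 2)}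

/-- The monomials `x_1^{e_1} x_2^{e_2} x_3^{e_3}`, `e ∈ E`, form a basis of the Nichols algebra
(in particular, they are pairwise distinct). -/
def IsMonomialBasis (r : Fin 3 → Fin 3 → Fin 3 → Fin 3 → 𝕜) (E : Set (Fin 3 → ℕ)) : Prop :=
  LinearIndependent 𝕜 (fun e : E => gen r 0 ^ e.1 0 * gen r 1 ^ e.1 1 * gen r 2 ^ e.1 2) ∧
    Submodule.span 𝕜
      (Set.range fun e : E => gen r 0 ^ e.1 0 * gen r 1 ^ e.1 1 * gen r 2 ^ e.1 2) = ⊤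

/-- Exponents of the monomials in `B_0`. -/
def B0 : Set (Fin 3 → ℕ) := {e | ∀ i, e i < 2}

/-- Exponents of the monomials in `B_1`. -/
def B1 : Set (Fin 3 → ℕ) := {e | e 0 < 2 ∧ e 1 < 2}

/-- Exponents of the monomials in `B_3`. -/
def B3 : Set (Fin 3 → ℕ) := Set.univ

end RankThree

end Nichols

end

/-! For every solution `c` of the braid equation, the ideal generated by the kernel of `1 + c` in
`V ⊗ V` is a homogeneous Hopf ideal. For the braidings at hand this kernel contains the listed
quadratic relations, so these lie in `J(V)`, and they allow every word to be straightened to a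
combination of the monomials `x₁^a₁ x₂^a₂ x₃^a₃` in question.

Conversely, the skew derivations `∂ᵢ`, given by the component of the coproduct in `V ⊗ T(V)`,
preserve every homogeneous Hopf ideal, and the counit vanishes on it. The functionals
`ε ∘ ∂₁^d₁ ∘ ∂₂^d₂ ∘ ∂₃^d₃` therefore vanish on `J(V)`, while they are triangular on the
straightened monomials, which are thus linearly independent modulo `J(V)`. For `t = -1` one first
trades `x₃²` for `s = x₃² + k x₁ x₂ + p x₁ x₃`, which satisfies
`∂₁ (s^m) = -m (a + p²) s^(m-1) x₁` and so vanishes in the Nichols algebra exactly when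
`a = -p²`. -/

noncomputable section

namespace Nichols

section FreeAlgebraMaps

variable {𝕜 : Type*} [Field 𝕜] {ι : Type*}

theorem mem_of_mulLeft_stable (S : Submodule 𝕜 (FreeAlgebra 𝕜 ι)) (one : 1 ∈ S)
    (mul : ∀ i, ∀ y ∈ S, FreeAlgebra.ι 𝕜 i * y ∈ S) (y : FreeAlgebra 𝕜 ι) : y ∈ S := by
  have key : ∀ x : FreeAlgebra 𝕜 ι, ∀ y ∈ S, x * y ∈ S := by
    intro x
    induction x using FreeAlgebra.induction with
    | grade0 c => intro y hy; rw [← Algebra.smul_def]; exact S.smul_mem _ hy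
    | grade1 i => exact mul i
    | mul a b ha hb => intro y hy; rw [mul_assoc]; exact ha _ (hb _ hy)
    | add a b ha hb => intro y hy; rw [add_mul]; exact S.add_mem (ha _ hy) (hb _ hy)
  simpa using key y 1 one

theorem linearMap_ext_of_mulLeft {M : Type*} [AddCommGroup M] [Module 𝕜 M]
    {f g : FreeAlgebra 𝕜 ι →ₗ[𝕜] M} (one : f 1 = g 1)
    (mul : ∀ i y, f y = g y → f (FreeAlgebra.ι 𝕜 i * y) = g (FreeAlgebra.ι 𝕜 i * y)) : f = g :=
  LinearMap.ext fun y => mem_of_mulLeft_stable (LinearMap.eqLocus f g) one mul y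

theorem lift_mem_of_stable {M : Type*} [AddCommGroup M] [Module 𝕜 M] {N : Submodule 𝕜 M}
    {f : ι → Module.End 𝕜 M} (hf : ∀ i, ∀ z ∈ N, f i z ∈ N) (x : FreeAlgebra 𝕜 ι) {z : M}
    (hz : z ∈ N) : FreeAlgebra.lift 𝕜 f x z ∈ N := by
  refine mem_of_mulLeft_stable (N.comap
    ((LinearMap.applyₗ z) ∘ₗ (FreeAlgebra.lift 𝕜 f).toLinearMap)) ?_ (fun i y hy => ?_) x
  · simpa using hz
  · simpa using hf i _ hy

theorem lift_mem_of_mem_span {M : Type*} [AddCommGroup M] [Module 𝕜 M] {N : Submodule 𝕜 M}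
    {f : ι → Module.End 𝕜 M} (hf : ∀ i, ∀ z ∈ N, f i z ∈ N) {G : Set (FreeAlgebra 𝕜 ι)}
    (hG : ∀ g ∈ G, ∀ z, FreeAlgebra.lift 𝕜 f g z ∈ N) {x : FreeAlgebra 𝕜 ι}
    (hx : x ∈ TwoSidedIdeal.span G) (z : M) : FreeAlgebra.lift 𝕜 f x z ∈ N := by
  induction hx using TwoSidedIdeal.span_induction generalizing z with
  | mem g hg => exact hG g hg z
  | zero => simp
  | add x y _ _ hx hy => simpa using N.add_mem (hx z) (hy z)
  | neg x _ hx => simpa using hx z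
  | left_absorb a x _ hx => simpa using lift_mem_of_stable hf a (hx z)
  | right_absorb b x _ hx => simpa using hx (FreeAlgebra.lift 𝕜 f b z)

theorem smul_mem_twoSidedIdeal {A : Type*} [Ring A] [Algebra 𝕜 A] (I : TwoSidedIdeal A) (c : 𝕜)
    {x : A} (hx : x ∈ I) : c • x ∈ I := by
  rw [Algebra.smul_def]
  exact I.mul_mem_left _ _ hx

theorem map_eq_zero_of_mem_span {R S : Type*} [Ring R] [Ring S] (f : R →+* S) {G : Set R}
    (h : ∀ g ∈ G, f g = 0) {x : R} (hx : x ∈ TwoSidedIdeal.span G) : f x = 0 := by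
  have : TwoSidedIdeal.span G ≤ TwoSidedIdeal.ker f :=
    TwoSidedIdeal.span_le.2 fun g hg => (TwoSidedIdeal.mem_ker f).2 (h g hg)
  exact (TwoSidedIdeal.mem_ker f).1 (this hx)

theorem algebraMapInv_ι (i : ι) :
    FreeAlgebra.algebraMapInv (FreeAlgebra.ι 𝕜 i) = 0 := by simp [FreeAlgebra.algebraMapInv]

theorem algebraMapInv_eq_zero_of_mem_degreePart (n : ℕ) {y : FreeAlgebra 𝕜 ι}
    (hy : y ∈ degreePart 𝕜 ι (n + 1)) : FreeAlgebra.algebraMapInv y = 0 := by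
  rw [degreePart, pow_succ'] at hy
  induction hy using Submodule.mul_induction_on' with
  | mem_mul_mem a ha b _ =>
    have : FreeAlgebra.algebraMapInv a = 0 := by
      induction ha using Submodule.span_induction with
      | mem x hx => obtain ⟨i, rfl⟩ := hx; exact algebraMapInv_ι i
      | zero => simp
      | add x y _ _ hx hy => simp [hx, hy]
      | smul c x _ hx => simp [hx]
    simp [this]
  | add x _ y _ hx hy => simp [hx, hy]

variable [DecidableEq ι]

/-- The algebra map `T(V) → 𝕜[ε]` with `x_k ↦ ε` and `x_i ↦ 0` for `i ≠ k`, which records the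
counit and the coefficient of `x_k`. -/
def dualCoeff (k : ι) : FreeAlgebra 𝕜 ι →ₐ[𝕜] DualNumber 𝕜 :=
  FreeAlgebra.lift 𝕜 fun i => if i = k then DualNumber.eps else 0

/-- The coefficient of the generator `x_k`. -/
def coeff (k : ι) : FreeAlgebra 𝕜 ι →ₗ[𝕜] 𝕜 :=
  TrivSqZeroExt.sndHom 𝕜 𝕜 ∘ₗ (dualCoeff k).toLinearMap

theorem fst_dualCoeff (k : ι) (y : FreeAlgebra 𝕜 ι) :
    (dualCoeff k y).fst = FreeAlgebra.algebraMapInv y := by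
  have : (TrivSqZeroExt.fstHom 𝕜 𝕜 𝕜).comp (dualCoeff k) = FreeAlgebra.algebraMapInv := by
    ext i
    by_cases h : i = k <;> simp [dualCoeff, FreeAlgebra.algebraMapInv, h]
  exact AlgHom.congr_fun this y

theorem coeff_mul (k : ι) (y z : FreeAlgebra 𝕜 ι) :
    coeff k (y * z) =
      FreeAlgebra.algebraMapInv y * coeff k z + coeff k y * FreeAlgebra.algebraMapInv z := by
  simp [coeff, fst_dualCoeff, mul_comm]

theorem coeff_one (k : ι) : coeff k (1 : FreeAlgebra 𝕜 ι) = 0 := by simp [coeff]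

theorem coeff_ι (k i : ι) : coeff k (FreeAlgebra.ι 𝕜 i) = if i = k then 1 else 0 := by
  by_cases h : i = k <;> simp [coeff, dualCoeff, h]

theorem coeff_eq_zero_of_mem_degreePart (k : ι) (n : ℕ) {y : FreeAlgebra 𝕜 ι}
    (hy : y ∈ degreePart 𝕜 ι (n + 2)) : coeff k y = 0 := by
  rw [show n + 2 = (0 + 1) + (n + 1) by omega, degreePart, pow_add] at hy
  induction hy using Submodule.mul_induction_on' with
  | mem_mul_mem a ha b hb =>
    rw [coeff_mul, algebraMapInv_eq_zero_of_mem_degreePart 0 ha,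
      algebraMapInv_eq_zero_of_mem_degreePart n hb, zero_mul, mul_zero, add_zero]
  | add x _ y _ hx hy => rw [map_add, hx, hy, add_zero]

end FreeAlgebraMaps

section Braiding

variable {𝕜 : Type*} [Field 𝕜] {ι : Type*} [Fintype ι] [DecidableEq ι] (r : ι → ι → ι → ι → 𝕜)

theorem braidLeft_apply (i l : ι) (y : FreeAlgebra 𝕜 ι) :
    braidLeft r i l y = braidMatrix r y i l := rfl

theorem braidLeft_one (i l : ι) : braidLeft r i l 1 = if i = l then 1 else 0 := by
  simp [braidLeft_apply, Matrix.one_apply]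

theorem braidLeft_mul (i l : ι) (y z : FreeAlgebra 𝕜 ι) :
    braidLeft r i l (y * z) = ∑ m, braidLeft r i m y * braidLeft r m l z := by
  simp [braidLeft_apply, Matrix.mul_apply]

theorem braidLeft_ι (i j l : ι) :
    braidLeft r i l (FreeAlgebra.ι 𝕜 j) = ∑ k, r i j k l • FreeAlgebra.ι 𝕜 k := by
  simp [braidLeft_apply, braidMatrix]

theorem algebraMapInv_braidLeft (i l : ι) (y : FreeAlgebra 𝕜 ι) :
    FreeAlgebra.algebraMapInv (braidLeft r i l y) =
      if i = l then FreeAlgebra.algebraMapInv y else 0 := by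
  have : FreeAlgebra.algebraMapInv.toLinearMap ∘ₗ braidLeft r i l =
      (if i = l then 1 else 0 : 𝕜) • FreeAlgebra.algebraMapInv.toLinearMap := by
    refine linearMap_ext_of_mulLeft ?_ fun j y _ => ?_
    · by_cases h : i = l <;> simp [braidLeft_one, h]
    · by_cases h : i = l <;> simp [braidLeft_mul, braidLeft_ι, algebraMapInv_ι, h]
  have h := LinearMap.congr_fun this y
  by_cases hil : i = l <;> simpa [hil] using h

theorem coeff_braidLeft (k i l : ι) (y : FreeAlgebra 𝕜 ι) :
    coeff k (braidLeft r i l y) = ∑ j, r i j k l * coeff j y := by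
  have : coeff k ∘ₗ braidLeft r i l = ∑ j, r i j k l • coeff j := by
    refine linearMap_ext_of_mulLeft ?_ fun j y _ => ?_
    · simp [braidLeft_one, coeff_one, apply_ite (coeff k)]
    · simp [braidLeft_mul, braidLeft_ι, algebraMapInv_ι, coeff_mul, coeff_ι,
        algebraMapInv_braidLeft, LinearMap.sum_apply]
  simpa [LinearMap.sum_apply] using LinearMap.congr_fun this y

end Braiding

section SkewDerivations

variable {𝕜 : Type*} [Field 𝕜]

/-- Contraction of the first tensor factor with a functional. -/
def contract {M : Type*} [AddCommGroup M] [Module 𝕜 M] (f : M →ₗ[𝕜] 𝕜) (N : Type*)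
    [AddCommGroup N] [Module 𝕜 N] : M ⊗[𝕜] N →ₗ[𝕜] N :=
  TensorProduct.lid 𝕜 N ∘ₗ f.rTensor N

@[simp]
theorem contract_tmul {M : Type*} [AddCommGroup M] [Module 𝕜 M] (f : M →ₗ[𝕜] 𝕜) {N : Type*}
    [AddCommGroup N] [Module 𝕜 N] (m : M) (n : N) : contract f N (m ⊗ₜ n) = f m • n := by
  simp [contract]

variable {ι : Type*}

/-- `I ⊗ A + A ⊗ I` for a two-sided ideal `I` of the free algebra `A`. -/
def tmulIdeal (I : TwoSidedIdeal (FreeAlgebra 𝕜 ι)) :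
    Submodule 𝕜 (FreeAlgebra 𝕜 ι ⊗[𝕜] FreeAlgebra 𝕜 ι) :=
  Submodule.span 𝕜 {z | ∃ u v : FreeAlgebra 𝕜 ι, (u ∈ I ∨ v ∈ I) ∧ z = u ⊗ₜ[𝕜] v}

theorem tmul_mem_left {I : TwoSidedIdeal (FreeAlgebra 𝕜 ι)} {u : FreeAlgebra 𝕜 ι} (hu : u ∈ I)
    (v : FreeAlgebra 𝕜 ι) : u ⊗ₜ[𝕜] v ∈ tmulIdeal I :=
  Submodule.subset_span ⟨u, v, Or.inl hu, rfl⟩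

theorem tmul_mem_right {I : TwoSidedIdeal (FreeAlgebra 𝕜 ι)} {v : FreeAlgebra 𝕜 ι} (hv : v ∈ I)
    (u : FreeAlgebra 𝕜 ι) : u ⊗ₜ[𝕜] v ∈ tmulIdeal I :=
  Submodule.subset_span ⟨u, v, Or.inr hv, rfl⟩

theorem contract_mem {I : TwoSidedIdeal (FreeAlgebra 𝕜 ι)} {f : FreeAlgebra 𝕜 ι →ₗ[𝕜] 𝕜}
    (hf : ∀ x ∈ I, f x = 0) {z : FreeAlgebra 𝕜 ι ⊗[𝕜] FreeAlgebra 𝕜 ι} (hz : z ∈ tmulIdeal I) :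
    contract f _ z ∈ I := by
  induction hz using Submodule.span_induction with
  | mem z hz =>
    obtain ⟨u, v, h | h, rfl⟩ := hz
    · simp [hf u h, I.zero_mem]
    · rw [contract_tmul]; exact smul_mem_twoSidedIdeal I _ h
  | zero => simp [I.zero_mem]
  | add x y _ _ hx hy => rw [map_add]; exact I.add_mem hx hy
  | smul c x _ hx => rw [map_smul]; exact smul_mem_twoSidedIdeal I c hx

variable [Fintype ι] [DecidableEq ι] (r : ι → ι → ι → ι → 𝕜)

/-- The comultiplication of `T(V)` as a linear map. -/
def comulLinear : FreeAlgebra 𝕜 ι →ₗ[𝕜] FreeAlgebra 𝕜 ι ⊗[𝕜] FreeAlgebra 𝕜 ι :=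
  LinearMap.applyₗ (1 ⊗ₜ[𝕜] 1) ∘ₗ (FreeAlgebra.lift 𝕜 (comulStep r)).toLinearMap

theorem comulLinear_one : comulLinear r 1 = 1 ⊗ₜ[𝕜] 1 := by
  simp [comulLinear]

theorem comulLinear_ι_mul (i : ι) (y : FreeAlgebra 𝕜 ι) :
    comulLinear r (FreeAlgebra.ι 𝕜 i * y) = comulStep r i (comulLinear r y) := by
  simp [comulLinear]

theorem contract_counit_comulStep (i : ι) (z : FreeAlgebra 𝕜 ι ⊗[𝕜] FreeAlgebra 𝕜 ι) :
    contract FreeAlgebra.algebraMapInv.toLinearMap _ (comulStep r i z) =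
      FreeAlgebra.ι 𝕜 i * contract FreeAlgebra.algebraMapInv.toLinearMap _ z := by
  have : contract FreeAlgebra.algebraMapInv.toLinearMap _ ∘ₗ comulStep r i =
      LinearMap.mulLeft 𝕜 (FreeAlgebra.ι 𝕜 i) ∘ₗ
        contract FreeAlgebra.algebraMapInv.toLinearMap _ := by
    ext u v
    simp [comulStep, LinearMap.sum_apply, algebraMapInv_ι, algebraMapInv_braidLeft]
  exact LinearMap.congr_fun this z

theorem contract_counit_comulLinear (y : FreeAlgebra 𝕜 ι) :
    contract FreeAlgebra.algebraMapInv.toLinearMap _ (comulLinear r y) = y := by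
  have : contract FreeAlgebra.algebraMapInv.toLinearMap _ ∘ₗ comulLinear r = LinearMap.id := by
    refine linearMap_ext_of_mulLeft ?_ fun j y hy => ?_
    · simp [comulLinear_one]
    · simp only [LinearMap.comp_apply, LinearMap.id_apply] at hy ⊢
      rw [comulLinear_ι_mul, contract_counit_comulStep, hy]
  exact LinearMap.congr_fun this y

theorem contract_coeff_comulStep (k i : ι) (z : FreeAlgebra 𝕜 ι ⊗[𝕜] FreeAlgebra 𝕜 ι) :
    contract (coeff k) _ (comulStep r i z) =
      (if i = k then 1 else 0 : 𝕜) • contract FreeAlgebra.algebraMapInv.toLinearMap _ z +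
        ∑ j, ∑ l, r i j k l • (FreeAlgebra.ι 𝕜 l * contract (coeff j) _ z) := by
  have : contract (coeff k) _ ∘ₗ comulStep r i =
      (if i = k then 1 else 0 : 𝕜) • contract FreeAlgebra.algebraMapInv.toLinearMap _ +
        ∑ j, ∑ l, r i j k l • (LinearMap.mulLeft 𝕜 (FreeAlgebra.ι 𝕜 l) ∘ₗ
          contract (coeff j) _) := by
    ext u v
    simp only [comulStep, LinearMap.sum_apply, TensorProduct.AlgebraTensorModule.curry_apply,
      LinearMap.restrictScalars_self, TensorProduct.curry_apply, LinearMap.comp_apply,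
      LinearMap.add_apply, TensorProduct.map_tmul, LinearMap.mulLeft_apply, LinearMap.id_apply,
      map_add, map_sum, contract_tmul, LinearMap.smul_apply, coeff_mul, algebraMapInv_ι, coeff_ι,
      coeff_braidLeft, zero_mul, zero_add, AlgHom.toLinearMap_apply, mul_smul_comm,
      Finset.sum_smul, smul_smul]
    rw [Finset.sum_comm]
  simpa only [LinearMap.comp_apply, LinearMap.add_apply, LinearMap.smul_apply,
    LinearMap.sum_apply, LinearMap.mulLeft_apply] using LinearMap.congr_fun this z

/-- The skew derivations `∂_k` of `T(V)`: the component of `Δ y` in `V ⊗ T(V)` is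
`∑ k, x_k ⊗ ∂_k y`. -/
def skewDer (k : ι) : FreeAlgebra 𝕜 ι →ₗ[𝕜] FreeAlgebra 𝕜 ι :=
  contract (coeff k) _ ∘ₗ comulLinear r

theorem skewDer_one (k : ι) : skewDer r k 1 = 0 := by
  simp [skewDer, comulLinear_one, coeff_one]

theorem skewDer_ι_mul (k i : ι) (y : FreeAlgebra 𝕜 ι) :
    skewDer r k (FreeAlgebra.ι 𝕜 i * y) = (if i = k then y else 0) +
      ∑ j, ∑ l, r i j k l • (FreeAlgebra.ι 𝕜 l * skewDer r j y) := by
  simp [skewDer, comulLinear_ι_mul, contract_coeff_comulStep, contract_counit_comulLinear]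

variable {r}

theorem IsHomogeneousHopfIdeal.coeff_eq_zero {I : TwoSidedIdeal (FreeAlgebra 𝕜 ι)}
    (hI : IsHomogeneousHopfIdeal r I) (k : ι) {x : FreeAlgebra 𝕜 ι} (hx : x ∈ I) :
    coeff k x = 0 := by
  obtain ⟨G, hG, rfl⟩ := hI.generated
  have hvanish : ∀ g ∈ G, dualCoeff k g = 0 := fun g hg => by
    obtain ⟨n, hn, hgn⟩ := hG g hg
    obtain ⟨m, rfl⟩ := Nat.exists_eq_add_of_le' hn
    exact TrivSqZeroExt.ext
      ((fst_dualCoeff k g).trans (algebraMapInv_eq_zero_of_mem_degreePart (m + 1) hgn))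
      (coeff_eq_zero_of_mem_degreePart k m hgn)
  exact congrArg TrivSqZeroExt.snd (map_eq_zero_of_mem_span (dualCoeff k).toRingHom hvanish hx)

theorem IsHomogeneousHopfIdeal.skewDer_mem {I : TwoSidedIdeal (FreeAlgebra 𝕜 ι)}
    (hI : IsHomogeneousHopfIdeal r I) (k : ι) {x : FreeAlgebra 𝕜 ι} (hx : x ∈ I) :
    skewDer r k x ∈ I :=
  contract_mem (fun _ h => hI.coeff_eq_zero k h) (hI.comul_mem x hx)

end SkewDerivations

section HopfIdeals

variable {𝕜 : Type*} [Field 𝕜] {ι : Type*} [Fintype ι] [DecidableEq ι] {r : ι → ι → ι → ι → 𝕜}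

theorem braidLeft_mem_span {G : Set (FreeAlgebra 𝕜 ι)}
    (hG : ∀ g ∈ G, ∀ i l, braidLeft r i l g ∈ TwoSidedIdeal.span G) {x : FreeAlgebra 𝕜 ι}
    (hx : x ∈ TwoSidedIdeal.span G) (i l : ι) : braidLeft r i l x ∈ TwoSidedIdeal.span G := by
  induction hx using TwoSidedIdeal.span_induction generalizing i l with
  | mem g hg => exact hG g hg i l
  | zero => simp
  | add x y _ _ hx hy => rw [map_add]; exact TwoSidedIdeal.add_mem _ (hx i l) (hy i l)
  | neg x _ hx => rw [map_neg]; exact TwoSidedIdeal.neg_mem _ (hx i l)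
  | left_absorb a x _ hx =>
    rw [braidLeft_mul]
    exact sum_mem fun m _ => TwoSidedIdeal.mul_mem_left _ _ _ (hx m l)
  | right_absorb b x _ hx =>
    rw [braidLeft_mul]
    exact sum_mem fun m _ => TwoSidedIdeal.mul_mem_right _ _ _ (hx i m)

theorem comulStep_tmul (i : ι) (u v : FreeAlgebra 𝕜 ι) :
    comulStep r i (u ⊗ₜ v) = (FreeAlgebra.ι 𝕜 i * u) ⊗ₜ v +
      ∑ l, braidLeft r i l u ⊗ₜ (FreeAlgebra.ι 𝕜 l * v) := by
  simp [comulStep, LinearMap.sum_apply]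

theorem antipodeStep_apply (i : ι) (y : FreeAlgebra 𝕜 ι) :
    antipodeStep r i y = -∑ l, braidLeft r i l y * FreeAlgebra.ι 𝕜 l := by
  simp [antipodeStep, LinearMap.sum_apply]

theorem comulStep_mem {I : TwoSidedIdeal (FreeAlgebra 𝕜 ι)}
    (hI : ∀ x ∈ I, ∀ i l, braidLeft r i l x ∈ I) (i : ι)
    {z : FreeAlgebra 𝕜 ι ⊗[𝕜] FreeAlgebra 𝕜 ι} (hz : z ∈ tmulIdeal I) :
    comulStep r i z ∈ tmulIdeal I := by
  induction hz using Submodule.span_induction with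
  | mem z hz =>
    obtain ⟨u, v, hu | hv, rfl⟩ := hz <;> rw [comulStep_tmul]
    · exact add_mem (tmul_mem_left (I.mul_mem_left _ _ hu) _)
        (sum_mem fun l _ => tmul_mem_left (hI u hu i l) _)
    · exact add_mem (tmul_mem_right hv _)
        (sum_mem fun l _ => tmul_mem_right (I.mul_mem_left _ _ hv) _)
  | zero => simp
  | add x y _ _ hx hy => rw [map_add]; exact add_mem hx hy
  | smul c x _ hx => rw [map_smul]; exact Submodule.smul_mem _ c hx

theorem isHomogeneousHopfIdeal_span {G : Set (FreeAlgebra 𝕜 ι)}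
    (hdeg : ∀ g ∈ G, ∃ n, 2 ≤ n ∧ g ∈ degreePart 𝕜 ι n)
    (hbraid : ∀ g ∈ G, ∀ i l, braidLeft r i l g ∈ TwoSidedIdeal.span G)
    (hcomul : ∀ g ∈ G, ∀ u v,
      FreeAlgebra.lift 𝕜 (comulStep r) g (u ⊗ₜ v) ∈ tmulIdeal (TwoSidedIdeal.span G))
    (hantipode : ∀ g ∈ G, ∀ u,
      FreeAlgebra.lift 𝕜 (antipodeStep r) g u ∈ TwoSidedIdeal.span G) :
    IsHomogeneousHopfIdeal r (TwoSidedIdeal.span G) where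
  generated := ⟨G, hdeg, rfl⟩
  comul_mem x hx := by
    refine lift_mem_of_mem_span
      (fun i z hz => comulStep_mem (fun y hy => braidLeft_mem_span hbraid hy) i hz)
      (fun g hg z => ?_) hx _
    induction z using TensorProduct.induction_on with
    | zero => simp
    | tmul u v => exact hcomul g hg u v
    | add y z hy hz => rw [map_add]; exact add_mem hy hz
  counit_eq_zero x hx := by
    refine map_eq_zero_of_mem_span FreeAlgebra.algebraMapInv.toRingHom (fun g hg => ?_) hx
    obtain ⟨n, hn, hgn⟩ := hdeg g hg
    obtain ⟨m, rfl⟩ := Nat.exists_eq_add_of_le' hn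
    exact algebraMapInv_eq_zero_of_mem_degreePart (m + 1) hgn
  antipode_mem x hx := by
    refine lift_mem_of_mem_span
      (N := (TwoSidedIdeal.asIdeal (TwoSidedIdeal.span G)).restrictScalars 𝕜) (fun i y hy => ?_)
      hantipode hx 1
    rw [antipodeStep_apply]
    exact neg_mem (sum_mem fun l _ =>
      TwoSidedIdeal.mul_mem_right _ _ _ (braidLeft_mem_span hbraid hy i l))

end HopfIdeals

section QuadraticIdeal

theorem sum_mem_of_sum_tmul_eq_zero {𝕜 κ M X P : Type*} [Field 𝕜] [Fintype κ] [DecidableEq κ]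
    [AddCommGroup M] [Module 𝕜 M] [AddCommGroup X] [Module 𝕜 X] [AddCommGroup P] [Module 𝕜 P]
    (K : (κ → 𝕜) →ₗ[𝕜] P) (W : κ → M) (hW : ∑ α, W α ⊗ₜ[𝕜] K (Pi.single α 1) = 0)
    (β : M →ₗ[𝕜] (κ → 𝕜) →ₗ[𝕜] X) {N : Submodule 𝕜 X}
    (hN : ∀ m, ∀ g ∈ LinearMap.ker K, β m g ∈ N) :
    ∑ α, β (W α) (Pi.single α 1) ∈ N := by
  -- Flatness of `M` gives `∑ α, W α ⊗ e_α ∈ M ⊗ ker K`.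
  obtain ⟨z, hz⟩ := (Module.Flat.lTensor_exact M K.exact_subtype_ker_map
    (∑ α, W α ⊗ₜ[𝕜] Pi.single α 1)).1 (by simpa using hW)
  have hsum : ∑ α, β (W α) (Pi.single α 1) =
      TensorProduct.lift β ((LinearMap.ker K).subtype.lTensor M z) := by simp [hz]
  rw [hsum]
  clear hz hsum
  induction z using TensorProduct.induction_on with
  | zero => simp
  | tmul m g => simpa using hN m g g.2
  | add y z hy hz => simpa only [map_add] using add_mem hy hz

variable {𝕜 : Type*} [Field 𝕜] {ι : Type*} [Fintype ι]

/-- The element `∑ i j, g (i, j) • x_i x_j` of `T(V)`. -/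
def quad : (ι × ι → 𝕜) →ₗ[𝕜] FreeAlgebra 𝕜 ι :=
  Fintype.linearCombination 𝕜 fun α => FreeAlgebra.ι 𝕜 α.1 * FreeAlgebra.ι 𝕜 α.2

theorem quad_apply (g : ι × ι → 𝕜) :
    quad g = ∑ α, g α • (FreeAlgebra.ι 𝕜 α.1 * FreeAlgebra.ι 𝕜 α.2) :=
  Fintype.linearCombination_apply ..

theorem quad_single [DecidableEq ι] (α : ι × ι) :
    quad (Pi.single α 1) = FreeAlgebra.ι 𝕜 α.1 * FreeAlgebra.ι 𝕜 α.2 := by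
  simp [quad, Fintype.linearCombination_apply_single]

theorem quad_mem_degreePart (g : ι × ι → 𝕜) : quad g ∈ degreePart 𝕜 ι 2 := by
  rw [quad_apply, degreePart, pow_two]
  exact sum_mem fun α _ => Submodule.smul_mem _ _
    (Submodule.mul_mem_mul (Submodule.subset_span ⟨_, rfl⟩) (Submodule.subset_span ⟨_, rfl⟩))

variable (r : ι → ι → ι → ι → 𝕜)

/-- The braid equation for `c`, evaluated on `x_i ⊗ x_j ⊗ x_k` at `x_u' ⊗ x_v' ⊗ x_l`. -/
def IsYangBaxter : Prop :=
  ∀ i j k u' v' l, ∑ u, ∑ m, ∑ v, r i j u m * r m k v l * r u v u' v' =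
    ∑ j', ∑ k', ∑ m, r j k j' k' * r i j' u' m * r m k' v' l

/-- The matrix of `c` acting on row vectors. -/
def braidingMatrix : Matrix (ι × ι) (ι × ι) 𝕜 :=
  Matrix.of fun α β => r α.1 α.2 β.1 β.2

/-- The matrix of the component of `c (x_i ⊗ -)` in `(V ⊗ V) ⊗ x_l`, for the induced braiding
`c : V ⊗ (V ⊗ V) → (V ⊗ V) ⊗ V`, acting on row vectors. -/
def braidingMatrixOnPairs (i l : ι) : Matrix (ι × ι) (ι × ι) 𝕜 :=
  Matrix.of fun α β => ∑ m, r i α.1 β.1 m * r m α.2 β.2 l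

variable {r} in
theorem IsYangBaxter.commute_braidingMatrixOnPairs (hr : IsYangBaxter r) (i l : ι) :
    Commute (braidingMatrixOnPairs r i l) (braidingMatrix r) := by
  ext α γ
  have h := hr i α.1 α.2 γ.1 γ.2 l
  simp only [Matrix.mul_apply, braidingMatrixOnPairs, braidingMatrix, Matrix.of_apply,
    Fintype.sum_prod_type, Finset.sum_mul, Finset.mul_sum, ← mul_assoc] at h ⊢
  rw [← h]
  exact Finset.sum_congr rfl fun _ _ => Finset.sum_comm

variable [DecidableEq ι]

/-- The ideal of `T(V)` generated by the kernel of `1 + c` in `V ⊗ V`. -/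
def quadraticIdeal : TwoSidedIdeal (FreeAlgebra 𝕜 ι) :=
  TwoSidedIdeal.span {y | ∃ g : ι × ι → 𝕜, Matrix.vecMul g (1 + braidingMatrix r) = 0 ∧ quad g = y}

/-- The braiding `(V ⊗ V) ⊗ T(V) → T(V) ⊗ (V ⊗ V)` in matrix form:
`c (x_i ⊗ x_j ⊗ y) = ∑ l m, (braidPair r y) (i, j) (l, m) ⊗ x_l ⊗ x_m`. -/
def braidPair : FreeAlgebra 𝕜 ι →ₐ[𝕜] Matrix (ι × ι) (ι × ι) (FreeAlgebra 𝕜 ι) :=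
  ((Matrix.reindexAlgEquiv 𝕜 (FreeAlgebra 𝕜 ι) (Equiv.prodComm ι ι)).toAlgHom.comp
    (Matrix.compAlgEquiv ι ι (FreeAlgebra 𝕜 ι) 𝕜).toAlgHom).comp
      ((braidMatrix r).mapMatrix.comp (braidMatrix r))

theorem braidPair_apply (y : FreeAlgebra 𝕜 ι) (α β : ι × ι) :
    braidPair r y α β = braidLeft r α.1 β.1 (braidLeft r α.2 β.2 y) := rfl

theorem braidPair_ι (k : ι) (α β : ι × ι) :
    braidPair r (FreeAlgebra.ι 𝕜 k) α β =
      ∑ u, (∑ v, r α.2 k v β.2 * r α.1 v u β.1) • FreeAlgebra.ι 𝕜 u := by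
  simp only [braidPair_apply, braidLeft_ι, map_sum, map_smul, Finset.smul_sum, smul_smul,
    Finset.sum_smul]
  exact Finset.sum_comm

theorem braidLeft_quad (i l : ι) (g : ι × ι → 𝕜) :
    braidLeft r i l (quad g) = quad (Matrix.vecMul g (braidingMatrixOnPairs r i l)) := by
  have on_single : ∀ α : ι × ι, braidLeft r i l (FreeAlgebra.ι 𝕜 α.1 * FreeAlgebra.ι 𝕜 α.2) =
      quad (braidingMatrixOnPairs r i l α) := fun α => by
    simp only [quad_apply, braidLeft_mul, braidLeft_ι, Finset.sum_mul_sum, smul_mul_smul_comm,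
      braidingMatrixOnPairs, Matrix.of_apply, Finset.sum_smul, Fintype.sum_prod_type]
    rw [Finset.sum_comm]
    exact Finset.sum_congr rfl fun _ _ => Finset.sum_comm
  simp only [quad_apply g, map_sum, map_smul, on_single, Matrix.vecMul_eq_sum]

variable {r}

theorem IsYangBaxter.commute_braidPair (hr : IsYangBaxter r) (y : FreeAlgebra 𝕜 ι) :
    Commute ((braidingMatrix r).map (algebraMap 𝕜 (FreeAlgebra 𝕜 ι))) (braidPair r y) := by
  induction y using FreeAlgebra.induction with
  | grade0 c => rw [AlgHom.commutes]; exact Algebra.commute_algebraMap_right ..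
  | grade1 k =>
    ext α γ
    simp only [Matrix.mul_apply, Matrix.map_apply, ← Algebra.smul_def, ← Algebra.commutes,
      braidPair_ι, Finset.smul_sum, smul_smul]
    rw [Finset.sum_comm, Finset.sum_comm (γ := ι × ι)]
    refine Finset.sum_congr rfl fun u _ => ?_
    rw [← Finset.sum_smul, ← Finset.sum_smul]
    have h := hr α.1 α.2 k u γ.1 γ.2
    simp only [braidingMatrix, Matrix.of_apply, Fintype.sum_prod_type, Finset.mul_sum,
      ← mul_assoc] at h ⊢
    rw [h, Finset.sum_comm_cycle]
    refine congrArg (· • _) (Finset.sum_congr rfl fun m _ => Finset.sum_comm.trans ?_)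
    simp only [mul_comm (r m _ _ _), mul_assoc]
  | mul y z hy hz => rw [map_mul]; exact hy.mul_right hz
  | add y z hy hz => rw [map_add]; exact hy.add_right hz

theorem IsYangBaxter.sum_smul_braidPair (hr : IsYangBaxter r) (y : FreeAlgebra 𝕜 ι)
    {g : ι × ι → 𝕜} (hg : Matrix.vecMul g (1 + braidingMatrix r) = 0) (γ : ι × ι) :
    ∑ β, (1 + braidingMatrix r) β γ • ∑ α, g α • braidPair r y α β = 0 := by
  have commute : ∀ α, ∑ β, (1 + braidingMatrix r) β γ • braidPair r y α β =
      ∑ β, (1 + braidingMatrix r) α β • braidPair r y β γ := fun α => by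
    have h := congr_fun₂ (hr.commute_braidPair y).eq α γ
    simp only [Matrix.mul_apply, Matrix.map_apply, ← Algebra.smul_def, ← Algebra.commutes] at h
    simp only [Matrix.add_apply, add_smul, Finset.sum_add_distrib, h, Matrix.one_apply, ite_smul,
      one_smul, zero_smul, Finset.sum_ite_eq, Finset.sum_ite_eq', Finset.mem_univ, if_true]
  calc ∑ β, (1 + braidingMatrix r) β γ • ∑ α, g α • braidPair r y α β
      = ∑ α, g α • ∑ β, (1 + braidingMatrix r) β γ • braidPair r y α β := by
        simp only [Finset.smul_sum, smul_comm (g _)]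
        exact Finset.sum_comm
    _ = ∑ β, Matrix.vecMul g (1 + braidingMatrix r) β • braidPair r y β γ := by
        simp only [commute, Matrix.vecMul, dotProduct, Finset.smul_sum, Finset.sum_smul, smul_smul]
        exact Finset.sum_comm
    _ = 0 := by simp [hg]

theorem IsYangBaxter.sum_braidPair_mem (hr : IsYangBaxter r) (y : FreeAlgebra 𝕜 ι)
    {g : ι × ι → 𝕜} (hg : Matrix.vecMul g (1 + braidingMatrix r) = 0)
    {X : Type*} [AddCommGroup X] [Module 𝕜 X]
    (B : FreeAlgebra 𝕜 ι →ₗ[𝕜] FreeAlgebra 𝕜 ι →ₗ[𝕜] X) {N : Submodule 𝕜 X}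
    (hN : ∀ m, ∀ z ∈ quadraticIdeal r, B m z ∈ N) :
    ∑ β, B (∑ α, g α • braidPair r y α β) (FreeAlgebra.ι 𝕜 β.1 * FreeAlgebra.ι 𝕜 β.2) ∈ N := by
  simp only [← quad_single]
  refine sum_mem_of_sum_tmul_eq_zero (Matrix.vecMulLinear (1 + braidingMatrix r)) _ ?_
    (B.compl₂ quad) fun m h hh =>
      hN m _ (TwoSidedIdeal.subset_span ⟨h, LinearMap.mem_ker.1 hh, rfl⟩)
  have expand : ∀ β, Matrix.vecMulLinear (1 + braidingMatrix r) (Pi.single β 1) =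
      ∑ γ, (1 + braidingMatrix r) β γ • Pi.single γ (1 : 𝕜) := fun β => by
    rw [Matrix.vecMulLinear_apply, Matrix.single_one_vecMul]
    exact pi_eq_sum_univ' _
  simp only [expand, TensorProduct.tmul_sum, ← TensorProduct.smul_tmul]
  rw [Finset.sum_comm]
  simp only [← TensorProduct.sum_tmul, hr.sum_smul_braidPair y hg, TensorProduct.zero_tmul,
    Finset.sum_const_zero]

theorem lift_comulStep_ι_mul_ι (α : ι × ι) (u v : FreeAlgebra 𝕜 ι) :
    FreeAlgebra.lift 𝕜 (comulStep r) (FreeAlgebra.ι 𝕜 α.1 * FreeAlgebra.ι 𝕜 α.2) (u ⊗ₜ v) =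
      (FreeAlgebra.ι 𝕜 α.1 * FreeAlgebra.ι 𝕜 α.2 * u) ⊗ₜ v +
      ∑ β, (1 + braidingMatrix r) α β • ∑ l,
        (FreeAlgebra.ι 𝕜 β.1 * braidLeft r β.2 l u) ⊗ₜ (FreeAlgebra.ι 𝕜 l * v) +
      ∑ β, braidPair r u α β ⊗ₜ (FreeAlgebra.ι 𝕜 β.1 * FreeAlgebra.ι 𝕜 β.2 * v) := by
  have swap : ∀ l, braidLeft r α.1 l (FreeAlgebra.ι 𝕜 α.2 * u) =
      ∑ β, braidingMatrix r α β • (FreeAlgebra.ι 𝕜 β.1 * braidLeft r β.2 l u) := fun l => by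
    simp only [braidLeft_mul, braidLeft_ι, braidingMatrix, Matrix.of_apply, Finset.sum_mul,
      smul_mul_assoc, Fintype.sum_prod_type]
    exact Finset.sum_comm
  have mixed : ∑ β, (1 + braidingMatrix r) α β • ∑ l,
        (FreeAlgebra.ι 𝕜 β.1 * braidLeft r β.2 l u) ⊗ₜ[𝕜] (FreeAlgebra.ι 𝕜 l * v) =
      ∑ l, (FreeAlgebra.ι 𝕜 α.1 * braidLeft r α.2 l u) ⊗ₜ (FreeAlgebra.ι 𝕜 l * v) +
      ∑ l, braidLeft r α.1 l (FreeAlgebra.ι 𝕜 α.2 * u) ⊗ₜ (FreeAlgebra.ι 𝕜 l * v) := by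
    simp only [Matrix.add_apply, Matrix.one_apply, add_smul, ite_smul, one_smul, zero_smul,
      Finset.sum_add_distrib, Finset.sum_ite_eq, Finset.mem_univ, if_true, swap,
      TensorProduct.sum_tmul, ← TensorProduct.smul_tmul',
      Finset.smul_sum (r := braidingMatrix r _ _)]
    rw [add_right_inj]
    exact Finset.sum_comm
  rw [mixed, map_mul, FreeAlgebra.lift_ι_apply, FreeAlgebra.lift_ι_apply, Module.End.mul_apply,
    comulStep_tmul, map_add, comulStep_tmul, map_sum]
  simp only [comulStep_tmul, Finset.sum_add_distrib, Fintype.sum_prod_type, braidPair_apply,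
    mul_assoc]
  rw [Finset.sum_comm (γ := ι)]
  abel

theorem lift_antipodeStep_ι_mul_ι (α : ι × ι) (u : FreeAlgebra 𝕜 ι) :
    FreeAlgebra.lift 𝕜 (antipodeStep r) (FreeAlgebra.ι 𝕜 α.1 * FreeAlgebra.ι 𝕜 α.2) u =
      ∑ β, braidPair r u α β * quad (braidingMatrix r β) := by
  simp only [map_mul, FreeAlgebra.lift_ι_apply, Module.End.mul_apply, antipodeStep_apply, map_neg,
    map_sum, Finset.sum_neg_distrib, neg_neg, braidLeft_mul, braidLeft_ι, Finset.sum_mul,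
    Finset.mul_sum, quad_apply, braidPair_apply, Fintype.sum_prod_type, braidingMatrix,
    Matrix.of_apply, mul_smul_comm, smul_mul_assoc, mul_assoc]
  exact Finset.sum_comm_cycle.trans
    (Finset.sum_congr rfl fun _ _ => Finset.sum_congr rfl fun _ _ => Finset.sum_comm)

theorem IsYangBaxter.lift_comulStep_quad_mem (hr : IsYangBaxter r)
    {g : ι × ι → 𝕜} (hg : Matrix.vecMul g (1 + braidingMatrix r) = 0) (u v : FreeAlgebra 𝕜 ι) :
    FreeAlgebra.lift 𝕜 (comulStep r) (quad g) (u ⊗ₜ v) ∈ tmulIdeal (quadraticIdeal r) := by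
  have expand : FreeAlgebra.lift 𝕜 (comulStep r) (quad g) (u ⊗ₜ v) = (quad g * u) ⊗ₜ v +
      ∑ β, Matrix.vecMul g (1 + braidingMatrix r) β • ∑ l,
        (FreeAlgebra.ι 𝕜 β.1 * braidLeft r β.2 l u) ⊗ₜ (FreeAlgebra.ι 𝕜 l * v) +
      ∑ β, (∑ α, g α • braidPair r u α β) ⊗ₜ (FreeAlgebra.ι 𝕜 β.1 * FreeAlgebra.ι 𝕜 β.2 * v) := by
    simp only [quad_apply, map_sum, map_smul, LinearMap.sum_apply, LinearMap.smul_apply,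
      lift_comulStep_ι_mul_ι, smul_add, Finset.sum_add_distrib, Finset.sum_mul, smul_mul_assoc,
      TensorProduct.sum_tmul, ← TensorProduct.smul_tmul', Matrix.vecMul, dotProduct,
      Finset.sum_smul, Finset.smul_sum (r := g _), smul_smul]
    exact congrArg₂ (· + ·) (congrArg (_ + ·) Finset.sum_comm) Finset.sum_comm
  rw [expand, hg]
  simp only [Pi.zero_apply, zero_smul, Finset.sum_const_zero, add_zero]
  have quad_mem : quad g ∈ quadraticIdeal r := TwoSidedIdeal.subset_span ⟨g, hg, rfl⟩
  refine add_mem (tmul_mem_left (TwoSidedIdeal.mul_mem_right _ _ _ quad_mem) v) ?_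
  exact hr.sum_braidPair_mem u hg
    ((TensorProduct.mk 𝕜 _ _).compl₂ (LinearMap.mulRight 𝕜 v))
    fun m z hz => tmul_mem_right (TwoSidedIdeal.mul_mem_right _ _ _ hz) m

theorem IsYangBaxter.lift_antipodeStep_quad_mem (hr : IsYangBaxter r)
    {g : ι × ι → 𝕜} (hg : Matrix.vecMul g (1 + braidingMatrix r) = 0) (u : FreeAlgebra 𝕜 ι) :
    FreeAlgebra.lift 𝕜 (antipodeStep r) (quad g) u ∈ quadraticIdeal r := by
  set W : ι × ι → FreeAlgebra 𝕜 ι := fun β => ∑ α, g α • braidPair r u α β with hW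
  have expand : FreeAlgebra.lift 𝕜 (antipodeStep r) (quad g) u =
      ∑ β, W β * quad (braidingMatrix r β) := by
    rw [quad_apply g]
    simp only [map_sum, map_smul, LinearMap.sum_apply, LinearMap.smul_apply,
      lift_antipodeStep_ι_mul_ι, Finset.smul_sum, hW, Finset.sum_mul, smul_mul_assoc]
    exact Finset.sum_comm
  have cancel : ∑ β, W β * quad ((1 + braidingMatrix r) β) = 0 := by
    simp only [quad_apply, Finset.mul_sum, mul_smul_comm]
    rw [Finset.sum_comm]
    simp only [← smul_mul_assoc, ← Finset.sum_mul, hW, hr.sum_smul_braidPair u hg, zero_mul,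
      Finset.sum_const_zero]
  have row : ∀ β, quad ((1 + braidingMatrix r) β) =
      FreeAlgebra.ι 𝕜 β.1 * FreeAlgebra.ι 𝕜 β.2 + quad (braidingMatrix r β) := fun β => by
    rw [← quad_single, ← map_add]
    exact congrArg quad (funext fun γ => by
      simp [Matrix.add_apply, Matrix.one_apply, Pi.single_apply, eq_comm])
  simp only [row, mul_add, Finset.sum_add_distrib] at cancel
  rw [expand, eq_neg_of_add_eq_zero_right cancel]
  exact neg_mem (hr.sum_braidPair_mem u hg (LinearMap.mul 𝕜 _)
    (N := (TwoSidedIdeal.asIdeal (quadraticIdeal r)).restrictScalars 𝕜)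
    fun m z hz => TwoSidedIdeal.mul_mem_left _ _ _ hz)

theorem IsYangBaxter.isHomogeneousHopfIdeal_quadraticIdeal (hr : IsYangBaxter r) :
    IsHomogeneousHopfIdeal r (quadraticIdeal r) := by
  refine isHomogeneousHopfIdeal_span ?_ ?_ ?_ ?_
  all_goals rintro _ ⟨g, hg, rfl⟩
  · exact ⟨2, le_rfl, quad_mem_degreePart g⟩
  · intro i l
    refine TwoSidedIdeal.subset_span ⟨_, ?_, (braidLeft_quad r i l g).symm⟩
    rw [Matrix.vecMul_vecMul,
      ((Commute.one_right _).add_right (hr.commute_braidingMatrixOnPairs i l)).eq,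
      ← Matrix.vecMul_vecMul, hg, Matrix.zero_vecMul]
  · exact hr.lift_comulStep_quad_mem hg
  · exact hr.lift_antipodeStep_quad_mem hg

end QuadraticIdeal

section BlockForm

variable {𝕜 : Type*} [Field 𝕜] {ι : Type*} [Fintype ι]

/-- The matrix of the component of `c (x_i ⊗ -)` in `V ⊗ x_l`, acting on row vectors. -/
def braidingBlock (r : ι → ι → ι → ι → 𝕜) (i l : ι) : Matrix ι ι 𝕜 :=
  Matrix.of fun j k => r i j k l

theorem isYangBaxter_of_braidingBlock {r : ι → ι → ι → ι → 𝕜}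
    (h : ∀ i j v l, ∑ u, ∑ m, r i j u m • (braidingBlock r m l * braidingBlock r u v) =
      ∑ k, ∑ m, r m k v l • (braidingBlock r j k * braidingBlock r i m)) :
    IsYangBaxter r := fun i j k u' v' l => by
  have hk := congr_fun₂ (h i j v' l) k u'
  simp only [Matrix.sum_apply, Matrix.smul_apply, Matrix.mul_apply, braidingBlock, Matrix.of_apply,
    smul_eq_mul, Finset.mul_sum, ← mul_assoc] at hk
  rw [hk, Finset.sum_comm_cycle]
  refine Finset.sum_congr rfl fun j' _ => Finset.sum_congr rfl fun k' _ =>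
    Finset.sum_congr rfl fun m _ => ?_
  ring

end BlockForm

section RankThreeBraiding

variable {𝕜 : Type*} [Field 𝕜] (t a b p q k : 𝕜)

theorem braidingBlock_c12 (i l : Fin 3) :
    braidingBlock (c12 t a b p q k) i l =
      ![![!![t, 0, 0; 0, t, 0; t * p, 0, t], 0, 0],
        ![0, !![t, 0, 0; 0, t, 0; t * q, 0, t], 0],
        ![!![t * b, 0, 0; 0, t * b, 0; t * a, -(t * k), t * b],
          !![0, 0, 0; t * (p - q), 0, 0; t * k, 0, 0],
          !![t, 0, 0; 0, t, 0; t * p, 0, t]]] i l := by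
  ext j m
  fin_cases i <;> fin_cases l <;> fin_cases j <;> fin_cases m <;> rfl

/-- The blocks of the braiding `c12` as expressions in the matrix units `N = E₃₁`, `E = E₂₁` and
`F = E₃₂`, for which arbitrary elements of an algebra may be substituted. -/
def blockSymbol {A : Type*} [Ring A] [Algebra 𝕜 A] (N E F : A) : Fin 3 → Fin 3 → A :=
  ![![t • 1 + (t * p) • N, 0, 0],
    ![0, t • 1 + (t * q) • N, 0],
    ![(t * b) • 1 - (t * k) • F + (t * a) • N, (t * (p - q)) • E + (t * k) • N,
      t • 1 + (t * p) • N]]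

theorem braidingBlock_c12_eq_blockSymbol :
    braidingBlock (c12 t a b p q k) = blockSymbol t a b p q k
      (Matrix.single 2 0 1) (Matrix.single 1 0 1) (Matrix.single 2 1 1) := by
  have N : Matrix.single 2 0 1 = !![0, 0, 0; 0, 0, 0; 1, 0, (0 : 𝕜)] := by
    ext i j; fin_cases i <;> fin_cases j <;> rfl
  have E : Matrix.single 1 0 1 = !![0, 0, 0; 1, 0, 0; 0, 0, (0 : 𝕜)] := by
    ext i j; fin_cases i <;> fin_cases j <;> rfl
  have F : Matrix.single 2 1 1 = !![0, 0, 0; 0, 0, 0; 0, 1, (0 : 𝕜)] := by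
    ext i j; fin_cases i <;> fin_cases j <;> rfl
  ext i l : 2
  rw [braidingBlock_c12]
  fin_cases i <;> fin_cases l <;> simp [blockSymbol, N, E, F, Matrix.one_fin_three]

theorem blockSymbol_exchange {A : Type*} [Ring A] [Algebra 𝕜 A] {N E F : A}
    (hNN : N * N = 0) (hNE : N * E = 0) (hEN : E * N = 0) (hNF : N * F = 0) (hFN : F * N = 0)
    (hEF : E * F = 0) (hFF : F * F = 0) (hFE : F * E = N) (i j v l : Fin 3) :
    ∑ u, ∑ m, c12 t a b p q k i j u m •
        (blockSymbol t a b p q k N E F m l * blockSymbol t a b p q k N E F u v) =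
      ∑ n, ∑ m, c12 t a b p q k m n v l •
        (blockSymbol t a b p q k N E F j n * blockSymbol t a b p q k N E F i m) := by
  have entry (i l : Fin 3) := congr_fun₂ (braidingBlock_c12 t a b p q k i l)
  have block := congr_fun₂ (blockSymbol.eq_1 t a b p q k N E F)
  simp only [braidingBlock, Matrix.of_apply (f := fun _ _ => c12 ..)] at entry
  generalize blockSymbol t a b p q k N E F = L at block ⊢
  generalize c12 t a b p q k = c at entry ⊢
  have c00 := entry 0 0; have c01 := entry 0 1; have c02 := entry 0 2
  have c10 := entry 1 0; have c11 := entry 1 1; have c12 := entry 1 2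
  have c20 := entry 2 0; have c21 := entry 2 1; have c22 := entry 2 2
  have L00 := block 0 0; have L01 := block 0 1; have L02 := block 0 2
  have L10 := block 1 0; have L11 := block 1 1; have L12 := block 1 2
  have L20 := block 2 0; have L21 := block 2 1; have L22 := block 2 2
  clear block entry
  simp only [Matrix.cons_val, Matrix.zero_apply] at *
  simp only [Fin.sum_univ_three]
  fin_cases i <;> fin_cases l <;>
    simp only [Fin.reduceFinMk, Fin.zero_eta, Fin.mk_one, Fin.isValue, L01, L02, L10, L12, c01,
      c02, c10, c12, mul_zero, zero_mul, smul_zero, add_zero, zero_add, zero_smul]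
  all_goals fin_cases j <;> fin_cases v <;>
    simp only [Fin.reduceFinMk, Fin.zero_eta, Fin.mk_one, Fin.isValue, L00, L01, L02, L10, L11, L12,
      L20, L21, L22, c00, c11, c20, c21, c22, Matrix.of_apply, Matrix.cons_val,
      add_zero, zero_add, sub_zero, mul_zero, zero_mul, smul_zero, zero_smul, one_mul, mul_one,
      add_mul, sub_mul, mul_add, mul_sub, smul_mul_assoc, mul_smul_comm,
      hNN, hNE, hEN, hNF, hFN, hEF, hFF, hFE] <;>
    module

theorem isYangBaxter_c12 : IsYangBaxter (c12 t a b p q k) := by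
  refine isYangBaxter_of_braidingBlock fun i j v l => ?_
  rw [braidingBlock_c12_eq_blockSymbol]
  exact blockSymbol_exchange t a b p q k (by simp) (by simp) (by simp) (by simp) (by simp)
    (by simp) (by simp) (by simp) i j v l

theorem vecMul_one_add_braidingMatrix_c12_eq_zero_iff (g : Fin 3 × Fin 3 → 𝕜) :
    Matrix.vecMul g (1 + braidingMatrix (c12 t a b p q k)) = 0 ↔
      g (0, 0) + t * (g (0, 0) + b * g (2, 0) + p * g (0, 2) + a * g (2, 2)) = 0 ∧
      g (0, 1) + t * (g (1, 0) + (p - q) * g (2, 1) + q * g (1, 2) + k * g (2, 2)) = 0 ∧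
      g (0, 2) + t * (g (2, 0) + p * g (2, 2)) = 0 ∧
      g (1, 0) + t * (g (0, 1) + b * g (2, 1) - k * g (2, 2)) = 0 ∧
      g (1, 1) + t * g (1, 1) = 0 ∧
      g (1, 2) + t * g (2, 1) = 0 ∧
      g (2, 0) + t * (g (0, 2) + b * g (2, 2)) = 0 ∧
      g (2, 1) + t * g (1, 2) = 0 ∧
      g (2, 2) + t * g (2, 2) = 0 := by
  have expand : Matrix.vecMul g (1 + braidingMatrix (c12 t a b p q k)) = 0 ↔
      ∀ m l, g (m, l) + ∑ i, ∑ j, g (i, j) * c12 t a b p q k i j m l = 0 := by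
    simp only [Matrix.vecMul_add, Matrix.vecMul_one, funext_iff, Prod.forall, Pi.add_apply,
      Pi.zero_apply, Matrix.vecMul, dotProduct, Fintype.sum_prod_type, braidingMatrix,
      Matrix.of_apply]
  have entry (i l : Fin 3) := congr_fun₂ (braidingBlock_c12 t a b p q k i l)
  simp only [braidingBlock, Matrix.of_apply (f := fun _ _ => c12 ..)] at entry
  simp only [expand, Fin.sum_univ_three, Fin.forall_fin_succ, IsEmpty.forall_iff,
    Fin.succ_zero_eq_one, Fin.succ_one_eq_two, and_true, Fin.isValue]
  simp only [entry, Matrix.cons_val, Matrix.of_apply, Matrix.zero_apply]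
  simp only [mul_zero, add_zero, zero_add, and_assoc]
  ring_nf

theorem quad_fin_three (g : Fin 3 × Fin 3 → 𝕜) :
    quad g = g (0, 0) • x 𝕜 0 ^ 2 + g (0, 1) • (x 𝕜 0 * x 𝕜 1) + g (0, 2) • (x 𝕜 0 * x 𝕜 2) +
      g (1, 0) • (x 𝕜 1 * x 𝕜 0) + g (1, 1) • x 𝕜 1 ^ 2 + g (1, 2) • (x 𝕜 1 * x 𝕜 2) +
      g (2, 0) • (x 𝕜 2 * x 𝕜 0) + g (2, 1) • (x 𝕜 2 * x 𝕜 1) + g (2, 2) • x 𝕜 2 ^ 2 := by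
  simp only [quad_apply, Fintype.sum_prod_type, Fin.sum_univ_three, pow_two, add_assoc]

variable {t a b p q k}

theorem mem_quadraticIdeal_of_vecMul {r : Fin 3 → Fin 3 → Fin 3 → Fin 3 → 𝕜}
    {y : FreeAlgebra 𝕜 (Fin 3)} (G : Matrix (Fin 3) (Fin 3) 𝕜)
    (hG : Matrix.vecMul (fun α => G α.1 α.2) (1 + braidingMatrix r) = 0)
    (hy : ∑ i, ∑ j, G i j • (x 𝕜 i * x 𝕜 j) = y) : y ∈ quadraticIdeal r :=
  TwoSidedIdeal.subset_span ⟨_, hG, by rw [quad_apply, Fintype.sum_prod_type, hy]⟩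

theorem quadraticIdeal_le_span_relA [NeZero (2 : 𝕜)] :
    quadraticIdeal (c12 1 a (p - 2 * q) p q k) ≤ TwoSidedIdeal.span (relA p q) := by
  refine TwoSidedIdeal.span_le.2 ?_
  rintro _ ⟨g, hg, rfl⟩
  rw [vecMul_one_add_braidingMatrix_c12_eq_zero_iff] at hg
  obtain ⟨h00, h01, h02, -, h11, h12, -, -, h22⟩ := hg
  have double {z : 𝕜} (h : z + 1 * z = 0) : z = 0 := by
    rw [one_mul, ← two_mul] at h
    exact (mul_eq_zero.1 h).resolve_left two_ne_zero
  have g22 := double h22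
  have g11 := double h11
  have g12 : g (1, 2) = -g (2, 1) := by linear_combination h12
  have g02 : g (0, 2) = -g (2, 0) := by linear_combination h02 - p * g22
  have g01 : g (0, 1) = -g (1, 0) + (2 * q - p) * g (2, 1) := by
    linear_combination h01 - q * g12 - k * g22
  have g00 : g (0, 0) = q * g (2, 0) :=
    sub_eq_zero.1 (double (by linear_combination h00 - p * g02 - a * g22))
  have expand : quad g = g (1, 0) • (x 𝕜 1 * x 𝕜 0 - x 𝕜 0 * x 𝕜 1) +
      g (2, 0) • (x 𝕜 2 * x 𝕜 0 - x 𝕜 0 * x 𝕜 2 + q • x 𝕜 0 ^ 2) +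
      g (2, 1) • (x 𝕜 2 * x 𝕜 1 - x 𝕜 1 * x 𝕜 2 + (2 * q - p) • (x 𝕜 0 * x 𝕜 1)) := by
    rw [quad_fin_three, g00, g01, g02, g11, g12, g22]
    module
  rw [SetLike.mem_coe, expand]
  refine add_mem (add_mem ?_ ?_) ?_ <;>
    exact smul_mem_twoSidedIdeal _ _ (TwoSidedIdeal.subset_span (by simp [relA]))

theorem span_relA_le_quadraticIdeal :
    TwoSidedIdeal.span (relA p q) ≤ quadraticIdeal (c12 1 a (p - 2 * q) p q k) := by
  refine TwoSidedIdeal.span_le.2 ?_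
  rintro _ (rfl | rfl | rfl)
  · refine mem_quadraticIdeal_of_vecMul !![0, -1, 0; 1, 0, 0; 0, 0, 0] ?_ ?_
    · simp [vecMul_one_add_braidingMatrix_c12_eq_zero_iff]
    · simp [Fin.sum_univ_three]; abel
  · refine mem_quadraticIdeal_of_vecMul !![q, 0, -1; 0, 0, 0; 1, 0, 0] ?_ ?_
    · simp [vecMul_one_add_braidingMatrix_c12_eq_zero_iff]; ring
    · simp [Fin.sum_univ_three, pow_two]; abel
  · refine mem_quadraticIdeal_of_vecMul !![0, 2 * q - p, 0; 0, 0, -1; 0, 1, 0] ?_ ?_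
    · simp [vecMul_one_add_braidingMatrix_c12_eq_zero_iff]; ring
    · simp [Fin.sum_univ_three]; abel

theorem quad_eq_of_vecMul_neg_one {g : Fin 3 × Fin 3 → 𝕜}
    (hg : Matrix.vecMul g (1 + braidingMatrix (c12 (-1) a (-p) p q k)) = 0) :
    (a + p ^ 2) * g (2, 2) = 0 ∧
    quad g = g (1, 0) • (x 𝕜 1 * x 𝕜 0 + x 𝕜 0 * x 𝕜 1) +
      g (2, 0) • (x 𝕜 2 * x 𝕜 0 + x 𝕜 0 * x 𝕜 2) +
      g (2, 1) • (x 𝕜 2 * x 𝕜 1 + x 𝕜 1 * x 𝕜 2 + p • (x 𝕜 0 * x 𝕜 1)) +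
      g (0, 0) • x 𝕜 0 ^ 2 + g (1, 1) • x 𝕜 1 ^ 2 +
      g (2, 2) • (x 𝕜 2 ^ 2 + k • (x 𝕜 0 * x 𝕜 1) + p • (x 𝕜 0 * x 𝕜 2)) := by
  rw [vecMul_one_add_braidingMatrix_c12_eq_zero_iff] at hg
  obtain ⟨h00, h01, h02, -, -, h12, -, -, -⟩ := hg
  have g12 : g (1, 2) = g (2, 1) := by linear_combination h12
  have g02 : g (0, 2) = g (2, 0) + p * g (2, 2) := by linear_combination h02
  have g01 : g (0, 1) = g (1, 0) + p * g (2, 1) + k * g (2, 2) := by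
    linear_combination h01 + q * g12
  refine ⟨by linear_combination -h00 - p * g02, ?_⟩
  rw [quad_fin_three, g01, g02, g12]
  module

theorem span_relB_le_quadraticIdeal :
    TwoSidedIdeal.span (relB p) ≤ quadraticIdeal (c12 (-1) a (-p) p q k) := by
  refine TwoSidedIdeal.span_le.2 ?_
  rintro _ (rfl | rfl | rfl | rfl | rfl)
  · refine mem_quadraticIdeal_of_vecMul !![0, 1, 0; 1, 0, 0; 0, 0, 0] ?_ ?_
    · simp [vecMul_one_add_braidingMatrix_c12_eq_zero_iff]
    · simp [Fin.sum_univ_three]; abel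
  · refine mem_quadraticIdeal_of_vecMul !![0, 0, 1; 0, 0, 0; 1, 0, 0] ?_ ?_
    · simp [vecMul_one_add_braidingMatrix_c12_eq_zero_iff]
    · simp [Fin.sum_univ_three]; abel
  · refine mem_quadraticIdeal_of_vecMul !![0, p, 0; 0, 0, 1; 0, 1, 0] ?_ ?_
    · simp [vecMul_one_add_braidingMatrix_c12_eq_zero_iff]
    · simp [Fin.sum_univ_three]; abel
  · refine mem_quadraticIdeal_of_vecMul !![1, 0, 0; 0, 0, 0; 0, 0, 0] ?_ ?_
    · simp [vecMul_one_add_braidingMatrix_c12_eq_zero_iff]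
    · simp [Fin.sum_univ_three, pow_two]
  · refine mem_quadraticIdeal_of_vecMul !![0, 0, 0; 0, 1, 0; 0, 0, 0] ?_ ?_
    · simp [vecMul_one_add_braidingMatrix_c12_eq_zero_iff]
    · simp [Fin.sum_univ_three, pow_two]

theorem quadraticIdeal_eq_span_relA [NeZero (2 : 𝕜)] :
    quadraticIdeal (c12 1 a (p - 2 * q) p q k) = TwoSidedIdeal.span (relA p q) :=
  le_antisymm quadraticIdeal_le_span_relA span_relA_le_quadraticIdeal

theorem quadraticIdeal_eq_span_relB (ha : a ≠ -p ^ 2) :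
    quadraticIdeal (c12 (-1) a (-p) p q k) = TwoSidedIdeal.span (relB p) := by
  refine le_antisymm (TwoSidedIdeal.span_le.2 ?_) span_relB_le_quadraticIdeal
  rintro _ ⟨g, hg, rfl⟩
  obtain ⟨hg22, expand⟩ := quad_eq_of_vecMul_neg_one hg
  rw [mul_eq_zero_iff_left fun h => ha (eq_neg_of_add_eq_zero_left h)] at hg22
  rw [SetLike.mem_coe, expand, hg22, zero_smul, add_zero]
  refine add_mem (add_mem (add_mem (add_mem ?_ ?_) ?_) ?_) ?_ <;>
    exact smul_mem_twoSidedIdeal _ _ (TwoSidedIdeal.subset_span (by simp [relB]))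

theorem quadraticIdeal_eq_span_relC :
    quadraticIdeal (c12 (-1) (-p ^ 2) (-p) p q k) = TwoSidedIdeal.span (relC p k) := by
  refine le_antisymm (TwoSidedIdeal.span_le.2 ?_) (TwoSidedIdeal.span_le.2 ?_)
  · rintro _ ⟨g, hg, rfl⟩
    rw [SetLike.mem_coe, (quad_eq_of_vecMul_neg_one hg).2]
    refine add_mem (add_mem (add_mem (add_mem (add_mem ?_ ?_) ?_) ?_) ?_) ?_ <;>
      exact smul_mem_twoSidedIdeal _ _ (TwoSidedIdeal.subset_span (by simp [relC]))
  · intro y hy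
    by_cases hyB : y ∈ relB p
    · exact span_relB_le_quadraticIdeal (TwoSidedIdeal.subset_span hyB)
    obtain rfl : y = x 𝕜 2 ^ 2 + k • (x 𝕜 0 * x 𝕜 1) + p • (x 𝕜 0 * x 𝕜 2) := by
      simp only [relB, relC, Set.mem_insert_iff, Set.mem_singleton_iff] at hy hyB
      tauto
    refine mem_quadraticIdeal_of_vecMul !![0, k, p; 0, 0, 0; 0, 0, 1] ?_ ?_
    · simp [vecMul_one_add_braidingMatrix_c12_eq_zero_iff]; ring
    · simp [Fin.sum_univ_three, pow_two]; abel

theorem isHomogeneousHopfIdeal_span_relA [NeZero (2 : 𝕜)] :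
    IsHomogeneousHopfIdeal (c12 1 a (p - 2 * q) p q k) (TwoSidedIdeal.span (relA p q)) := by
  rw [← quadraticIdeal_eq_span_relA (a := a) (k := k)]
  exact IsYangBaxter.isHomogeneousHopfIdeal_quadraticIdeal (isYangBaxter_c12 _ _ _ _ _ _)

theorem isHomogeneousHopfIdeal_span_relB (ha : a ≠ -p ^ 2) :
    IsHomogeneousHopfIdeal (c12 (-1) a (-p) p q k) (TwoSidedIdeal.span (relB p)) := by
  rw [← quadraticIdeal_eq_span_relB (q := q) (k := k) ha]
  exact IsYangBaxter.isHomogeneousHopfIdeal_quadraticIdeal (isYangBaxter_c12 _ _ _ _ _ _)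

theorem isHomogeneousHopfIdeal_span_relC :
    IsHomogeneousHopfIdeal (c12 (-1) (-p ^ 2) (-p) p q k) (TwoSidedIdeal.span (relC p k)) := by
  rw [← quadraticIdeal_eq_span_relC (q := q)]
  exact IsYangBaxter.isHomogeneousHopfIdeal_quadraticIdeal (isYangBaxter_c12 _ _ _ _ _ _)

end RankThreeBraiding

section Quotient

variable {𝕜 : Type*} [Field 𝕜] {ι : Type*} (I : TwoSidedIdeal (FreeAlgebra 𝕜 ι))

/-- The projection of the tensor algebra onto its quotient by `I`. -/
abbrev proj : FreeAlgebra 𝕜 ι →ₐ[𝕜] I.ringCon.Quotient := RingCon.mkₐ 𝕜 I.ringCon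

/-- The images of the basis vectors of `V` in the quotient of the tensor algebra by `I`. -/
abbrev projGen (i : ι) : I.ringCon.Quotient := proj I (FreeAlgebra.ι 𝕜 i)

variable {I}

theorem proj_eq_zero_iff {y : FreeAlgebra 𝕜 ι} : proj I y = 0 ↔ y ∈ I := by
  conv_rhs => rw [← I.ker_ringCon_mk']
  exact (TwoSidedIdeal.mem_ker _).symm

theorem exists_proj_eq (u : I.ringCon.Quotient) : ∃ y, proj I y = u :=
  RingCon.mkₐ_surjective _ u

theorem exists_comp_proj_eq {M : Type*} [AddCommGroup M] [Module 𝕜 M]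
    (f : FreeAlgebra 𝕜 ι →ₗ[𝕜] M) (hf : ∀ y ∈ I, f y = 0) :
    ∃ g : I.ringCon.Quotient →ₗ[𝕜] M, g ∘ₗ (proj I).toLinearMap = f := by
  obtain ⟨s, hs⟩ := (proj I).toLinearMap.exists_rightInverse_of_surjective
    (LinearMap.range_eq_top.2 exists_proj_eq)
  refine ⟨f ∘ₗ s, LinearMap.ext fun y => sub_eq_zero.1 ?_⟩
  rw [LinearMap.comp_apply, LinearMap.comp_apply, ← map_sub]
  refine hf _ (proj_eq_zero_iff.1 ?_)
  rw [map_sub, sub_eq_zero]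
  exact LinearMap.congr_fun hs (proj I y)

namespace IsHomogeneousHopfIdeal

variable [Fintype ι] [DecidableEq ι] {r : ι → ι → ι → ι → 𝕜}

theorem exists_comp_proj_eq_skewDer (hI : IsHomogeneousHopfIdeal r I) (k : ι) :
    ∃ D : Module.End 𝕜 I.ringCon.Quotient,
      D ∘ₗ (proj I).toLinearMap = (proj I).toLinearMap ∘ₗ skewDer r k :=
  exists_comp_proj_eq _ fun _ hy => proj_eq_zero_iff.2 (hI.skewDer_mem k hy)

theorem exists_comp_proj_eq_algebraMapInv (hI : IsHomogeneousHopfIdeal r I) :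
    ∃ ε : I.ringCon.Quotient →ₗ[𝕜] 𝕜,
      ε ∘ₗ (proj I).toLinearMap = FreeAlgebra.algebraMapInv.toLinearMap :=
  exists_comp_proj_eq _ hI.counit_eq_zero

/-- The skew derivation induced on the quotient of the tensor algebra by a Hopf ideal. -/
def der (hI : IsHomogeneousHopfIdeal r I) (k : ι) : Module.End 𝕜 I.ringCon.Quotient :=
  (hI.exists_comp_proj_eq_skewDer k).choose

/-- The counit of the quotient of the tensor algebra by a Hopf ideal. -/
def counit (hI : IsHomogeneousHopfIdeal r I) : I.ringCon.Quotient →ₗ[𝕜] 𝕜 :=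
  hI.exists_comp_proj_eq_algebraMapInv.choose

variable (hI : IsHomogeneousHopfIdeal r I)

theorem der_proj (k : ι) (y : FreeAlgebra 𝕜 ι) : hI.der k (proj I y) = proj I (skewDer r k y) :=
  LinearMap.congr_fun (hI.exists_comp_proj_eq_skewDer k).choose_spec y

theorem counit_proj (y : FreeAlgebra 𝕜 ι) :
    hI.counit (proj I y) = FreeAlgebra.algebraMapInv y :=
  LinearMap.congr_fun hI.exists_comp_proj_eq_algebraMapInv.choose_spec y

theorem counit_one : hI.counit 1 = 1 := by
  rw [← map_one (proj I), counit_proj, map_one]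

theorem der_one (k : ι) : hI.der k 1 = 0 := by
  rw [← map_one (proj I), der_proj, skewDer_one, map_zero]

theorem der_projGen_mul (k i : ι) (u : I.ringCon.Quotient) :
    hI.der k (projGen I i * u) = (if i = k then u else 0) +
      ∑ j, ∑ l, r i j k l • (projGen I l * hI.der j u) := by
  obtain ⟨y, rfl⟩ := exists_proj_eq u
  simp only [← map_mul, der_proj, skewDer_ι_mul, map_add, map_sum, map_smul, apply_ite (proj I),
    map_zero]

theorem der_pow_proj_mem {K : TwoSidedIdeal (FreeAlgebra 𝕜 ι)} (hK : IsHomogeneousHopfIdeal r K)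
    (k : ι) (n : ℕ) {y : FreeAlgebra 𝕜 ι} (hy : y ∈ K) :
    ∃ z ∈ K, (hI.der k ^ n) (proj I y) = proj I z := by
  induction n generalizing y with
  | zero => exact ⟨y, hy, rfl⟩
  | succ n ih =>
    rw [pow_succ, Module.End.mul_apply, der_proj]
    exact ih (hK.skewDer_mem k hy)

end IsHomogeneousHopfIdeal

end Quotient

section Lowering

variable {𝕜 A : Type*} [Field 𝕜] [AddCommGroup A] [Module 𝕜 A]

/-- The operator `D` lowers `u` to `w` in exactly `n` steps: `D ^ n` maps `u` to a nonzero multiple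
of `w`, which is killed by `D`. -/
structure LowersTo (D : Module.End 𝕜 A) (n : ℕ) (u w : A) : Prop where
  map_eq_zero : D w = 0
  exists_pow_apply : ∃ c : 𝕜, c ≠ 0 ∧ (D ^ n) u = c • w

variable {D : Module.End 𝕜 A}

theorem LowersTo.pow_apply_eq_zero {m n : ℕ} {u w : A} (h : LowersTo D m u w) (hmn : m < n) :
    (D ^ n) u = 0 := by
  obtain ⟨c, -, hc⟩ := h.exists_pow_apply
  obtain ⟨j, rfl⟩ := Nat.exists_eq_add_of_lt hmn
  rw [show m + j + 1 = j + 1 + m by omega, pow_add, pow_succ, Module.End.mul_apply,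
    Module.End.mul_apply, hc, map_smul, h.map_eq_zero, smul_zero, map_zero]

theorem LowersTo.map {n : ℕ} {u w : A} (h : LowersTo D n u w) (T : Module.End 𝕜 A) {c : 𝕜}
    (hc : c ≠ 0) (hT : ∀ u, D (T u) = c • T (D u)) : LowersTo D n (T u) (T w) := by
  obtain ⟨d, hd, hu⟩ := h.exists_pow_apply
  have hpow (j : ℕ) : (D ^ j) (T u) = c ^ j • T ((D ^ j) u) := by
    induction j with
    | zero => simp
    | succ j ih => simp only [pow_succ', Module.End.mul_apply, ih, map_smul, hT, smul_smul,
        mul_comm]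
  refine ⟨by rw [hT, h.map_eq_zero, map_zero, smul_zero], c ^ n * d,
    mul_ne_zero (pow_ne_zero n hc) hd, ?_⟩
  rw [hpow, hu, map_smul, smul_smul]

theorem lowersTo_of_chain {z : ℕ → A} {c : ℕ → 𝕜} (h0 : D (z 0) = 0)
    (h : ∀ j, D (z (j + 1)) = c j • z j) {n : ℕ} (hc : ∀ j < n, c j ≠ 0) :
    LowersTo D n (z n) (z 0) := by
  have hpow (n : ℕ) : (D ^ n) (z n) = (∏ j ∈ Finset.range n, c j) • z 0 := by
    induction n with
    | zero => simp
    | succ n ih =>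
      rw [pow_succ, Module.End.mul_apply, h, map_smul, ih, smul_smul, Finset.prod_range_succ,
        mul_comm]
  exact ⟨h0, _, Finset.prod_ne_zero_iff.2 fun j hj => hc j (Finset.mem_range.1 hj), hpow n⟩

/-- The operators `D 2`, `D 1`, `D 0` successively lower `v` to `w` in `d 2`, `d 1`, `d 0` steps. -/
def LexLowersTo (D : Fin 3 → Module.End 𝕜 A) (d : Fin 3 → ℕ) (v w : A) : Prop :=
  ∃ u₁ u₀, LowersTo (D 2) (d 2) v u₁ ∧ LowersTo (D 1) (d 1) u₁ u₀ ∧ LowersTo (D 0) (d 0) u₀ w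

/-- The functional `ε ∂_0^{d 0} ∂_1^{d 1} ∂_2^{d 2}`. -/
def derFunctional (ε : A →ₗ[𝕜] 𝕜) (D : Fin 3 → Module.End 𝕜 A) (d : Fin 3 → ℕ) : A →ₗ[𝕜] 𝕜 :=
  ε ∘ₗ (D 0 ^ d 0) ∘ₗ (D 1 ^ d 1) ∘ₗ (D 2 ^ d 2)

/-- Exponents ordered lexicographically, the last entry being the most significant one. -/
def lexKey (d : Fin 3 → ℕ) : ℕ ×ₗ ℕ ×ₗ ℕ := toLex (d 2, toLex (d 1, d 0))

theorem lexKey_injective : Function.Injective lexKey := by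
  intro d d' h
  simp only [lexKey, toLex_inj, Prod.mk.injEq] at h
  ext i
  fin_cases i
  exacts [h.2.2, h.2.1, h.1]

variable {D : Fin 3 → Module.End 𝕜 A} {ε : A →ₗ[𝕜] 𝕜} {d d' : Fin 3 → ℕ} {v w : A}

theorem LexLowersTo.derFunctional_eq_zero (h : LexLowersTo D d' v w)
    (hlt : lexKey d' < lexKey d) : derFunctional ε D d v = 0 := by
  obtain ⟨u₁, u₀, h₂, h₁, h₀⟩ := h
  obtain ⟨c₂, -, hc₂⟩ := h₂.exists_pow_apply
  obtain ⟨c₁, -, hc₁⟩ := h₁.exists_pow_apply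
  simp only [lexKey, Prod.Lex.toLex_lt_toLex] at hlt
  simp only [derFunctional, LinearMap.comp_apply]
  rcases hlt with h | ⟨e₂, h | ⟨e₁, h⟩⟩
  · rw [h₂.pow_apply_eq_zero h, map_zero, map_zero, map_zero]
  · rw [← e₂, hc₂, map_smul, h₁.pow_apply_eq_zero h, smul_zero, map_zero, map_zero]
  · rw [← e₂, hc₂, map_smul, ← e₁, hc₁, smul_smul, map_smul, h₀.pow_apply_eq_zero h, smul_zero,
      map_zero]

theorem LexLowersTo.derFunctional_ne_zero (h : LexLowersTo D d v w) (hw : ε w ≠ 0) :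
    derFunctional ε D d v ≠ 0 := by
  obtain ⟨u₁, u₀, h₂, h₁, h₀⟩ := h
  obtain ⟨c₂, h₂, hc₂⟩ := h₂.exists_pow_apply
  obtain ⟨c₁, h₁, hc₁⟩ := h₁.exists_pow_apply
  obtain ⟨c₀, h₀, hc₀⟩ := h₀.exists_pow_apply
  simpa [derFunctional, hc₂, hc₁, hc₀, h₂, h₁, h₀] using hw

theorem eq_zero_of_triangular {E K : Type*} [LinearOrder K] {key : E → K}
    (hkey : Function.Injective key) {v : E → A} {φ : E → A →ₗ[𝕜] 𝕜}
    (hlt : ∀ e e', key e' < key e → φ e (v e') = 0) (hne : ∀ e, φ e (v e) ≠ 0)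
    {c : E →₀ 𝕜} (hc : ∀ e, φ e (Finsupp.linearCombination 𝕜 v c) = 0) : c = 0 := by
  by_contra hne0
  obtain ⟨e, he, hmax⟩ := c.support.exists_max_image key (Finsupp.support_nonempty_iff.2 hne0)
  have hφ := hc e
  rw [Finsupp.linearCombination_apply, Finsupp.sum, map_sum, Finset.sum_eq_single_of_mem e he,
    map_smul, smul_eq_mul, mul_eq_zero] at hφ
  · exact hφ.elim (Finsupp.mem_support_iff.1 he) (hne e)
  · intro e' he' hee
    rw [map_smul, hlt e e' ((hmax e' he').lt_of_ne fun h => hee (hkey h)), smul_zero]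

variable {E : Type*} {d : E → Fin 3 → ℕ} {v : E → A}

theorem eq_zero_of_derFunctional_eq_zero (hd : Function.Injective d)
    (hv : ∀ e, LexLowersTo D (d e) (v e) w) (hw : ε w ≠ 0) {c : E →₀ 𝕜}
    (hc : ∀ e, derFunctional ε D (d e) (Finsupp.linearCombination 𝕜 v c) = 0) : c = 0 :=
  eq_zero_of_triangular (lexKey_injective.comp hd)
    (fun _ e' h => (hv e').derFunctional_eq_zero h) (fun e => (hv e).derFunctional_ne_zero hw) hc

theorem linearIndependent_of_lexLowersTo (hd : Function.Injective d)
    (hv : ∀ e, LexLowersTo D (d e) (v e) w) (hw : ε w ≠ 0) : LinearIndependent 𝕜 v :=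
  linearIndependent_iff.2 fun _ hc =>
    eq_zero_of_derFunctional_eq_zero hd hv hw fun _ => by rw [hc, map_zero]

end Lowering

section NicholsIdeal

variable {𝕜 : Type*} [Field 𝕜] {r : Fin 3 → Fin 3 → Fin 3 → Fin 3 → 𝕜}
  {I : TwoSidedIdeal (FreeAlgebra 𝕜 (Fin 3))}

theorem IsHomogeneousHopfIdeal.derFunctional_proj_eq_zero (hI : IsHomogeneousHopfIdeal r I)
    {K : TwoSidedIdeal (FreeAlgebra 𝕜 (Fin 3))} (hK : IsHomogeneousHopfIdeal r K)
    {y : FreeAlgebra 𝕜 (Fin 3)} (hy : y ∈ K) (d : Fin 3 → ℕ) :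
    derFunctional hI.counit hI.der d (proj I y) = 0 := by
  obtain ⟨y₂, hy₂, h₂⟩ := hI.der_pow_proj_mem hK 2 (d 2) hy
  obtain ⟨y₁, hy₁, h₁⟩ := hI.der_pow_proj_mem hK 1 (d 1) hy₂
  obtain ⟨y₀, hy₀, h₀⟩ := hI.der_pow_proj_mem hK 0 (d 0) hy₁
  simp only [derFunctional, LinearMap.comp_apply, h₂, h₁, h₀, counit_proj,
    hK.counit_eq_zero y₀ hy₀]

theorem IsHomogeneousHopfIdeal.nicholsIdeal_eq (hI : IsHomogeneousHopfIdeal r I) {E : Type*}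
    {d : E → Fin 3 → ℕ} (hd : Function.Injective d) {v : E → I.ringCon.Quotient}
    (hv : ∀ e, LexLowersTo hI.der (d e) (v e) 1)
    (hspan : Submodule.span 𝕜 (Set.range v) = ⊤) : nicholsIdeal r = I := by
  refine le_antisymm (sSup_le fun K hK y hy => proj_eq_zero_iff.1 ?_) (le_sSup hI)
  obtain ⟨c, hc⟩ := (Finsupp.mem_span_range_iff_exists_finsupp (v := v) (x := proj I y)).1
    (hspan ▸ Submodule.mem_top)
  have hc0 : c = 0 := eq_zero_of_derFunctional_eq_zero (ε := hI.counit) hd hv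
    (by simp [hI.counit_one]) fun e => by
      rw [Finsupp.linearCombination_apply, hc]
      exact hI.derFunctional_proj_eq_zero hK hy (d e)
  rw [← hc, hc0, Finsupp.sum_zero_index]

end NicholsIdeal

section SkewDerRules

variable {𝕜 A : Type*} [Field 𝕜] [Ring A] [Algebra 𝕜 A]

/-- The rules `∂_k(x_i u) = δ_{ik} u + ∑ j l, r^{ij}_{kl} x_l ∂_j(u)` for the skew derivations `D k`
of an algebra with generators `X i`, written out for the braiding `c12`. -/
structure SkewDerRules (t a b p q k : 𝕜) (X : Fin 3 → A) (D : Fin 3 → Module.End 𝕜 A) : Prop where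
  map_one (i : Fin 3) : D i 1 = 0
  map00 (u : A) : D 0 (X 0 * u) = u + t • (X 0 * D 0 u) + (t * p) • (X 0 * D 2 u)
  map01 (u : A) : D 0 (X 1 * u) = t • (X 1 * D 0 u) + (t * q) • (X 1 * D 2 u)
  map02 (u : A) : D 0 (X 2 * u) = t • (X 2 * D 0 u) + (t * b) • (X 0 * D 0 u) +
    (t * (p - q)) • (X 1 * D 1 u) + (t * p) • (X 2 * D 2 u) + (t * k) • (X 1 * D 2 u) +
    (t * a) • (X 0 * D 2 u)
  map10 (u : A) : D 1 (X 0 * u) = t • (X 0 * D 1 u)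
  map11 (u : A) : D 1 (X 1 * u) = u + t • (X 1 * D 1 u)
  map12 (u : A) : D 1 (X 2 * u) =
    t • (X 2 * D 1 u) + (t * b) • (X 0 * D 1 u) - (t * k) • (X 0 * D 2 u)
  map20 (u : A) : D 2 (X 0 * u) = t • (X 0 * D 2 u)
  map21 (u : A) : D 2 (X 1 * u) = t • (X 1 * D 2 u)
  map22 (u : A) : D 2 (X 2 * u) = u + t • (X 2 * D 2 u) + (t * b) • (X 0 * D 2 u)

theorem IsHomogeneousHopfIdeal.skewDerRules {t a b p q k : 𝕜}
    {I : TwoSidedIdeal (FreeAlgebra 𝕜 (Fin 3))}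
    (hI : IsHomogeneousHopfIdeal (c12 t a b p q k) I) :
    SkewDerRules t a b p q k (projGen I) hI.der := by
  have entry (i l : Fin 3) := congr_fun₂ (braidingBlock_c12 t a b p q k i l)
  simp only [braidingBlock, Matrix.of_apply (f := fun _ _ => c12 t a b p q k _ _ _ _)] at entry
  constructor
  · exact hI.der_one
  all_goals
    intro u
    simp only [hI.der_projGen_mul, Fin.sum_univ_three, entry, Matrix.cons_val, Matrix.of_apply,
      Matrix.zero_apply, Fin.reduceEq, if_true, if_false]
    module

end SkewDerRules

section Relations

variable {𝕜 A : Type*} [Field 𝕜] [Ring A] [Algebra 𝕜 A]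

theorem mul_mul_of_eq {x y z : A} (h : x * y = z) (w : A) : x * (y * w) = z * w := by
  rw [← mul_assoc, h]

/-- The elements `X i` satisfy the relations `relA`, solved for the products that are not in normal
order. -/
structure SatisfiesRelA (p q : 𝕜) (X : Fin 3 → A) : Prop where
  mul10 : X 1 * X 0 = X 0 * X 1
  mul20 : X 2 * X 0 = X 0 * X 2 - q • (X 0 * X 0)
  mul21 : X 2 * X 1 = X 1 * X 2 + (p - 2 * q) • (X 0 * X 1)

/-- The elements `X i` satisfy the relations `relB`, solved for the products that are not in normal
order. -/
structure SatisfiesRelB (p : 𝕜) (X : Fin 3 → A) : Prop where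
  mul10 : X 1 * X 0 = -(X 0 * X 1)
  mul20 : X 2 * X 0 = -(X 0 * X 2)
  mul21 : X 2 * X 1 = -(X 1 * X 2) - p • (X 0 * X 1)
  mul00 : X 0 * X 0 = 0
  mul11 : X 1 * X 1 = 0

/-- The elements `X i` satisfy the relations `relC`, solved for the products that are not in normal
order. -/
structure SatisfiesRelC (p k : 𝕜) (X : Fin 3 → A) : Prop extends SatisfiesRelB p X where
  mul22 : X 2 * X 2 = -(k • (X 0 * X 1)) - p • (X 0 * X 2)

variable {p : 𝕜} {I : TwoSidedIdeal (FreeAlgebra 𝕜 (Fin 3))}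

theorem satisfiesRelA_projGen {q : 𝕜} (hI : ∀ g ∈ relA p q, g ∈ I) :
    SatisfiesRelA p q (projGen I) := by
  simp only [relA, Set.forall_mem_insert, Set.mem_singleton_iff, forall_eq, ← proj_eq_zero_iff,
    map_add, map_sub, map_mul, map_smul, pow_two] at hI
  obtain ⟨h10, h20, h21⟩ := hI
  exact ⟨sub_eq_zero.1 h10, sub_eq_zero.1 (.trans (by module) h20),
    sub_eq_zero.1 (.trans (by module) h21)⟩

theorem satisfiesRelB_projGen (hI : ∀ g ∈ relB p, g ∈ I) : SatisfiesRelB p (projGen I) := by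
  simp only [relB, Set.forall_mem_insert, Set.mem_singleton_iff, forall_eq, ← proj_eq_zero_iff,
    map_add, map_mul, map_smul, pow_two] at hI
  obtain ⟨h10, h20, h21, h00, h11⟩ := hI
  exact ⟨eq_neg_of_add_eq_zero_left h10, eq_neg_of_add_eq_zero_left h20,
    sub_eq_zero.1 (.trans (by module) h21), h00, h11⟩

theorem relB_subset_relC (k : 𝕜) : relB p ⊆ relC p k := by
  simp [relB, relC, Set.insert_subset_iff]

theorem satisfiesRelC_projGen {k : 𝕜} (hI : ∀ g ∈ relC p k, g ∈ I) :
    SatisfiesRelC p k (projGen I) where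
  toSatisfiesRelB := satisfiesRelB_projGen fun g hg => hI g (relB_subset_relC k hg)
  mul22 := by
    have h22 := proj_eq_zero_iff.2
      (hI (x 𝕜 2 ^ 2 + k • (x 𝕜 0 * x 𝕜 1) + p • (x 𝕜 0 * x 𝕜 2)) (by simp [relC]))
    simp only [map_add, map_mul, map_smul, pow_two] at h22
    exact sub_eq_zero.1 (.trans (by module) h22)

end Relations

section Polynomial

variable {𝕜 A : Type*} [Field 𝕜] [Ring A] [Algebra 𝕜 A]

/-- The monomial `x_1^{e_1} x_2^{e_2} x_3^{e_3}`. -/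
def mono (X : Fin 3 → A) (e : Fin 3 → ℕ) : A := X 0 ^ e 0 * X 1 ^ e 1 * X 2 ^ e 2

theorem map_pow_mul_eq_smul {D : Module.End 𝕜 A} {Z : A} {c : 𝕜}
    (h : ∀ u, D (Z * u) = c • (Z * D u)) (n : ℕ) (u : A) :
    D (Z ^ n * u) = c ^ n • (Z ^ n * D u) := by
  induction n with
  | zero => simp
  | succ n ih => rw [pow_succ', mul_assoc, h, ih, mul_smul_comm, smul_smul, ← pow_succ', mul_assoc]

theorem LowersTo.pow_mul {D : Module.End 𝕜 A} {n : ℕ} {u w : A} (h : LowersTo D n u w) {Z : A}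
    {c : 𝕜} (hc : c ≠ 0) (hZ : ∀ u, D (Z * u) = c • (Z * D u)) (m : ℕ) :
    LowersTo D n (Z ^ m * u) (Z ^ m * w) :=
  h.map (LinearMap.mulLeft 𝕜 (Z ^ m)) (pow_ne_zero m hc) (map_pow_mul_eq_smul hZ m)

theorem pow_succ_apply_mul {D : Module.End 𝕜 A} {Z W : A}
    (hZ : ∀ u, D (Z * u) = u + Z * D u + W * D u) (hW : ∀ u, D (W * u) = W * D u) (n : ℕ) (u : A) :
    (D ^ (n + 1)) (Z * u) =
      (n + 1) • (D ^ n) u + Z * (D ^ (n + 1)) u + (n + 1) • (W * (D ^ (n + 1)) u) := by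
  have hWpow (n : ℕ) (u : A) : (D ^ n) (W * u) = W * (D ^ n) u := by
    induction n generalizing u with
    | zero => simp
    | succ n ih => rw [pow_succ, Module.End.mul_apply, hW, ih, Module.End.mul_apply]
  induction n generalizing u with
  | zero => simp [hZ]
  | succ n ih =>
    have hshift (j : ℕ) (w : A) : (D ^ j) (D w) = (D ^ (j + 1)) w := by
      rw [pow_succ, Module.End.mul_apply]
    rw [← hshift, hZ, map_add, map_add, ih, hWpow]
    simp only [hshift]
    module

theorem lowersTo_pow [CharZero 𝕜] {D : Module.End 𝕜 A} {Z W : A}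
    (hZ : ∀ u, D (Z * u) = u + Z * D u + W * D u) (hW : ∀ u, D (W * u) = W * D u)
    (h1 : D 1 = 0) (n : ℕ) : LowersTo D n (Z ^ n) 1 := by
  refine ⟨h1, n.factorial, Nat.cast_ne_zero.2 n.factorial_ne_zero, ?_⟩
  induction n with
  | zero => simp
  | succ n ih =>
    have hvanish : (D ^ (n + 1)) (Z ^ n) = 0 := by
      rw [pow_succ', Module.End.mul_apply, ih, map_smul, h1, smul_zero]
    rw [pow_succ' Z, pow_succ_apply_mul hZ hW, hvanish, ih, mul_zero, mul_zero, smul_zero,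
      Nat.factorial_succ]
    push_cast
    module

theorem SkewDerRules.lexLowersTo_mono [CharZero 𝕜] {a b p q k : 𝕜} {X : Fin 3 → A}
    {D : Fin 3 → Module.End 𝕜 A} (h : SkewDerRules 1 a b p q k X D) (e : Fin 3 → ℕ) :
    LexLowersTo D e (mono X e) 1 := by
  have h20 (u : A) : D 2 (X 0 * u) = (1 : 𝕜) • (X 0 * D 2 u) := h.map20 u
  have h21 (u : A) : D 2 (X 1 * u) = (1 : 𝕜) • (X 1 * D 2 u) := h.map21 u
  have h10 (u : A) : D 1 (X 0 * u) = (1 : 𝕜) • (X 0 * D 1 u) := h.map10 u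
  have lower₂ : LowersTo (D 2) (e 2) (X 2 ^ e 2) 1 :=
    lowersTo_pow (W := b • X 0) (fun u => by rw [h.map22, smul_mul_assoc]; module)
      (fun u => by rw [smul_mul_assoc, map_smul, h20, one_smul, smul_mul_assoc]) (h.map_one 2) _
  have lower₁ : LowersTo (D 1) (e 1) (X 1 ^ e 1) 1 :=
    lowersTo_pow (W := 0) (fun u => by rw [h.map11, zero_mul]; module) (fun u => by simp)
      (h.map_one 1) _
  have lower₀ : LowersTo (D 0) (e 0) (X 0 ^ e 0) 1 := by
    have hpow (j : ℕ) : D 2 (X 0 ^ j) = 0 := by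
      simpa [h.map_one] using map_pow_mul_eq_smul h20 j 1
    have hchain (j : ℕ) : D 0 (X 0 ^ (j + 1)) = ((j + 1 : ℕ) : 𝕜) • X 0 ^ j := by
      induction j with
      | zero => simpa [h.map_one] using h.map00 1
      | succ j ih =>
        rw [pow_succ', h.map00, ih, hpow, mul_smul_comm, ← pow_succ', mul_zero, smul_zero]
        push_cast
        module
    simpa using lowersTo_of_chain (z := fun j => X 0 ^ j) (by simp [h.map_one]) hchain
      fun j _ => Nat.cast_ne_zero.2 j.succ_ne_zero
  refine ⟨X 0 ^ e 0 * X 1 ^ e 1, X 0 ^ e 0, ?_, ?_, lower₀⟩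
  · simpa [mono, mul_assoc] using
      (lower₂.pow_mul one_ne_zero h21 (e 1)).pow_mul one_ne_zero h20 (e 0)
  · simpa using lower₁.pow_mul one_ne_zero h10 (e 0)

end Polynomial

section ExteriorPart

variable {𝕜 A : Type*} [Field 𝕜] [Ring A] [Algebra 𝕜 A] {a p q k : 𝕜} {X : Fin 3 → A}
  {D : Fin 3 → Module.End 𝕜 A}

/-- The element `x_3² + k x_1 x_2 + p x_1 x_3`, which vanishes in the Nichols algebra exactly when
`a = -p²`. -/
def squareRel (p k : 𝕜) (X : Fin 3 → A) : A := X 2 * X 2 + k • (X 0 * X 1) + p • (X 0 * X 2)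

theorem SatisfiesRelB.commute_squareRel (hX : SatisfiesRelB p X) (k : 𝕜) :
    Commute (squareRel p k X) (X 0) := by
  simp only [Commute, SemiconjBy, squareRel, mul_add, add_mul, mul_assoc, mul_smul_comm,
    smul_mul_assoc, hX.mul10, hX.mul20, mul_neg, mul_mul_of_eq hX.mul00,
    mul_mul_of_eq hX.mul20, neg_mul, zero_mul]
  module

/-- The monomials `s^{⌊e_3/2⌋} x_1^{e_1} x_2^{e_2} x_3^{e_3 mod 2}` with `s = squareRel p k X`. -/
def squareMono (p k : 𝕜) (X : Fin 3 → A) (e : Fin 3 → ℕ) : A :=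
  squareRel p k X ^ (e 2 / 2) * (X 0 ^ e 0 * X 1 ^ e 1 * X 2 ^ (e 2 % 2))

/-- The numbers of steps in which the skew derivations lower `squareMono p k X e` to `1`. -/
def squareDegree (e : Fin 3 → ℕ) : Fin 3 → ℕ := ![2 * (e 2 / 2) + e 0, e 1, e 2 % 2]

/-- The scalars by which `∂_1` acts along the chain `1, x_1, s, s x_1, s², …` with
`s = squareRel p k X` and `μ = a + p²`. -/
def chainCoeff (μ : 𝕜) (j : ℕ) : 𝕜 := if j % 2 = 0 then 1 else -(((j / 2 + 1 : ℕ) : 𝕜) * μ)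

theorem lowersTo_pow_of_lt_two {D : Module.End 𝕜 A} {Z : A} (h1 : D 1 = 0) (hZ : D Z = 1) {n : ℕ}
    (hn : n < 2) : LowersTo D n (Z ^ n) 1 := by
  refine ⟨h1, 1, one_ne_zero, ?_⟩
  interval_cases n <;> simp [hZ]

namespace SkewDerRules

variable (h : SkewDerRules (-1) a (-p) p q k X D) (hX : SatisfiesRelB p X)
include h hX

theorem map_zero_squareRel_mul (u : A) : D 0 (squareRel p k X * u) =
    squareRel p k X * D 0 u - (a + p ^ 2) • (X 0 * u) + (2 * p) • (squareRel p k X * D 2 u) := by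
  simp only [squareRel, add_mul, smul_mul_assoc, mul_assoc, map_add, map_smul, h.map00, h.map01,
    h.map02, h.map12, h.map21, h.map22, mul_add, mul_sub, mul_smul_comm, mul_mul_of_eq hX.mul00,
    mul_mul_of_eq hX.mul10, mul_mul_of_eq hX.mul20, mul_mul_of_eq hX.mul21, sub_mul, neg_mul,
    mul_neg, zero_mul]
  module

theorem map_one_squareRel_mul (u : A) :
    D 1 (squareRel p k X * u) = squareRel p k X * D 1 u := by
  simp only [squareRel, add_mul, smul_mul_assoc, mul_assoc, map_add, map_smul, h.map10, h.map11,
    h.map12, h.map22, mul_add, mul_sub, mul_smul_comm, mul_mul_of_eq hX.mul00,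
    mul_mul_of_eq hX.mul20, neg_mul, zero_mul]
  module

theorem map_two_squareRel_mul (u : A) :
    D 2 (squareRel p k X * u) = squareRel p k X * D 2 u := by
  simp only [squareRel, add_mul, smul_mul_assoc, mul_assoc, map_add, map_smul, h.map20, h.map21,
    h.map22, mul_add, mul_smul_comm, mul_mul_of_eq hX.mul00,
    mul_mul_of_eq hX.mul20, neg_mul, zero_mul]
  module

theorem map_two_squareRel_pow (m : ℕ) : D 2 (squareRel p k X ^ m) = 0 := by
  have hone (u : A) : D 2 (squareRel p k X * u) = (1 : 𝕜) • (squareRel p k X * D 2 u) := by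
    rw [h.map_two_squareRel_mul hX, one_smul]
  simpa [h.map_one] using map_pow_mul_eq_smul hone m 1

theorem map_zero_squareRel_pow (m : ℕ) : D 0 (squareRel p k X ^ (m + 1)) =
    -(((m + 1 : ℕ) : 𝕜) * (a + p ^ 2)) • (squareRel p k X ^ m * X 0) := by
  have hcomm (n : ℕ) : X 0 * squareRel p k X ^ n = squareRel p k X ^ n * X 0 :=
    ((hX.commute_squareRel k).pow_left n).eq.symm
  induction m with
  | zero => simpa [h.map_one, ← neg_smul] using h.map_zero_squareRel_mul hX 1
  | succ m ih =>
    rw [pow_succ', h.map_zero_squareRel_mul hX, ih, h.map_two_squareRel_pow hX, hcomm,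
      mul_zero, smul_zero, mul_smul_comm, ← mul_assoc, ← pow_succ']
    push_cast
    module

theorem map_zero_squareRel_pow_mul (m : ℕ) :
    D 0 (squareRel p k X ^ m * X 0) = squareRel p k X ^ m := by
  have hcomm (n : ℕ) := ((hX.commute_squareRel k).pow_left n).eq
  rw [hcomm, h.map00, h.map_two_squareRel_pow hX, mul_zero, smul_zero, add_zero]
  cases m with
  | zero => simp [h.map_one]
  | succ m => rw [h.map_zero_squareRel_pow hX, hcomm, mul_smul_comm, ← mul_assoc, hX.mul00]; simp

theorem lowersTo_squareRel_pow_mul {l m : ℕ} (hl : l < 2)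
    (hc : ∀ j < 2 * m + l, chainCoeff (a + p ^ 2) j ≠ 0) :
    LowersTo (D 0) (2 * m + l) (squareRel p k X ^ m * X 0 ^ l) 1 := by
  let z : ℕ → A := fun j => squareRel p k X ^ (j / 2) * X 0 ^ (j % 2)
  have hz (m l : ℕ) (hl : l < 2) : z (2 * m + l) = squareRel p k X ^ m * X 0 ^ l := by
    simp only [z, show (2 * m + l) / 2 = m by omega, show (2 * m + l) % 2 = l by omega]
  have hchain (j : ℕ) : D 0 (z (j + 1)) = chainCoeff (a + p ^ 2) j • z j := by
    rcases Nat.even_or_odd' j with ⟨m, rfl | rfl⟩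
    · rw [hz m 1 one_lt_two, pow_one, h.map_zero_squareRel_pow_mul hX, chainCoeff,
        if_pos (by omega), one_smul, ← add_zero (2 * m), hz m 0 two_pos, pow_zero, mul_one]
    · rw [show 2 * m + 1 + 1 = 2 * (m + 1) + 0 by omega, hz _ 0 two_pos, pow_zero, mul_one,
        h.map_zero_squareRel_pow hX, chainCoeff, if_neg (by omega), hz m 1 one_lt_two, pow_one,
        show (2 * m + 1) / 2 = m by omega]
  have hz0 : z 0 = 1 := by simp [z]
  rw [← hz m l hl, ← hz0]
  exact lowersTo_of_chain (by rw [hz0, h.map_one]) hchain hc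

theorem lexLowersTo_squareMono {e : Fin 3 → ℕ} (he : e ∈ B1)
    (hc : ∀ j < 2 * (e 2 / 2) + e 0, chainCoeff (a + p ^ 2) j ≠ 0) :
    LexLowersTo D (squareDegree e) (squareMono p k X e) 1 := by
  have hneg : (-1 : 𝕜) ≠ 0 := neg_ne_zero.2 one_ne_zero
  have h1s (u : A) : D 1 (squareRel p k X * u) = (1 : 𝕜) • (squareRel p k X * D 1 u) := by
    rw [h.map_one_squareRel_mul hX, one_smul]
  have h2s (u : A) : D 2 (squareRel p k X * u) = (1 : 𝕜) • (squareRel p k X * D 2 u) := by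
    rw [h.map_two_squareRel_mul hX, one_smul]
  have lower₂ : LowersTo (D 2) (e 2 % 2) (X 2 ^ (e 2 % 2)) 1 :=
    lowersTo_pow_of_lt_two (h.map_one 2) (by simpa [h.map_one] using h.map22 1)
      (Nat.mod_lt _ two_pos)
  have lower₁ : LowersTo (D 1) (e 1) (X 1 ^ e 1) 1 :=
    lowersTo_pow_of_lt_two (h.map_one 1) (by simpa [h.map_one] using h.map11 1) he.2
  refine ⟨squareRel p k X ^ (e 2 / 2) * (X 0 ^ e 0 * X 1 ^ e 1),
    squareRel p k X ^ (e 2 / 2) * X 0 ^ e 0, ?_, ?_, h.lowersTo_squareRel_pow_mul hX he.1 hc⟩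
  · simpa [squareMono, squareDegree, mul_assoc] using
      ((lower₂.pow_mul hneg h.map21 (e 1)).pow_mul hneg h.map20 (e 0)).pow_mul one_ne_zero h2s
        (e 2 / 2)
  · simpa [squareDegree] using (lower₁.pow_mul hneg h.map10 (e 0)).pow_mul one_ne_zero h1s (e 2 / 2)

end SkewDerRules

end ExteriorPart

section GKDimension

open Filter Topology

theorem tendsto_log_natCast_atTop : Tendsto (fun n : ℕ => Real.log n) atTop atTop :=
  Real.tendsto_log_atTop.comp tendsto_natCast_atTop_atTop

theorem tendsto_log_mul_pow_div_log {c : ℝ} (hc : 0 < c) (d : ℕ) :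
    Tendsto (fun n : ℕ => ((Real.log (c * n ^ d) / Real.log n : ℝ) : EReal)) atTop
      (𝓝 (d : EReal)) := by
  have hlim : Tendsto (fun n : ℕ => Real.log c / Real.log n + d) atTop (𝓝 (0 + d)) :=
    (tendsto_log_natCast_atTop.const_div_atTop _).add tendsto_const_nhds
  rw [zero_add] at hlim
  refine (continuous_coe_real_ereal.tendsto _).comp (hlim.congr' ?_)
  filter_upwards [tendsto_log_natCast_atTop.eventually_gt_atTop 0, eventually_ge_atTop 1]
    with n hlog hn
  have hn0 : (n : ℝ) ^ d ≠ 0 := pow_ne_zero _ (Nat.cast_ne_zero.2 (by omega))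
  rw [Real.log_mul hc.ne' hn0, Real.log_pow]
  field_simp

theorem limsup_log_div_log_le {f : ℕ → ℕ} {C : ℝ} (hC : 1 ≤ C) {d : ℕ}
    (hf : ∀ n, 1 ≤ n → (f n : ℝ) ≤ C * n ^ d) :
    limsup (fun n : ℕ => ((Real.log (f n) / Real.log n : ℝ) : EReal)) atTop ≤ d := by
  rw [← (tendsto_log_mul_pow_div_log (one_pos.trans_le hC) d).limsup_eq]
  refine limsup_le_limsup ?_
  filter_upwards [tendsto_log_natCast_atTop.eventually_gt_atTop 0, eventually_ge_atTop 1]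
    with n hlog hn
  refine EReal.coe_le_coe_iff.2 (div_le_div_of_nonneg_right ?_ hlog.le)
  rcases Nat.eq_zero_or_pos (f n) with h0 | hpos
  · have hn' : (1 : ℝ) ≤ n := Nat.one_le_cast.2 hn
    rw [h0, Nat.cast_zero, Real.log_zero]
    exact Real.log_nonneg (one_le_mul_of_one_le_of_one_le hC (one_le_pow₀ hn'))
  · exact Real.log_le_log (Nat.cast_pos.2 hpos) (hf n hn)

theorem le_limsup_log_div_log {f : ℕ → ℕ} {c : ℝ} (hc : 0 < c) {d : ℕ}
    (hf : ∀ n : ℕ, c * (n : ℝ) ^ d ≤ f n) :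
    (d : EReal) ≤ limsup (fun n : ℕ => ((Real.log (f n) / Real.log n : ℝ) : EReal)) atTop := by
  rw [← (tendsto_log_mul_pow_div_log hc d).limsup_eq]
  refine limsup_le_limsup ?_
  filter_upwards [tendsto_log_natCast_atTop.eventually_gt_atTop 0, eventually_ge_atTop 1]
    with n hlog hn
  have : (0 : ℝ) < n := Nat.cast_pos.2 hn
  exact EReal.coe_le_coe_iff.2
    (div_le_div_of_nonneg_right (Real.log_le_log (by positivity) (hf n)) hlog.le)

variable {𝕜 A : Type*} [Field 𝕜] [Ring A] [Algebra 𝕜 A]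

/-- An exhaustive multiplicative filtration of an algebra by finite-dimensional subspaces. -/
structure IsFiniteFiltration (F : ℕ → Submodule 𝕜 A) : Prop where
  mono : Monotone F
  one_mem : 1 ∈ F 0
  mul_le (i j : ℕ) : F i * F j ≤ F (i + j)
  exists_mem (u : A) : ∃ n, u ∈ F n
  fg (n : ℕ) : (F n).FG

namespace IsFiniteFiltration

variable {F : ℕ → Submodule 𝕜 A} (hF : IsFiniteFiltration F)
include hF

theorem iSup_pow_le {W : Submodule 𝕜 A} {N : ℕ} (hW : W ≤ F N) (n : ℕ) :
    ⨆ i ∈ Finset.range (n + 1), W ^ i ≤ F (N * n) := by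
  have hpow (i : ℕ) : W ^ i ≤ F (N * i) := by
    induction i with
    | zero => rw [pow_zero, mul_zero, Submodule.one_le]; exact hF.one_mem
    | succ i ih =>
      rw [pow_succ, mul_add, mul_one]
      exact (mul_le_mul' ih hW).trans (hF.mul_le _ _)
  refine iSup₂_le fun i hi => (hpow i).trans (hF.mono ?_)
  exact Nat.mul_le_mul_left N (Nat.lt_succ_iff.1 (Finset.mem_range.1 hi))

theorem exists_le_of_fg {W : Submodule 𝕜 A} (hW : W.FG) : ∃ N, W ≤ F N := by
  obtain ⟨s, rfl⟩ := hW
  choose f hf using hF.exists_mem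
  exact ⟨s.sup f, Submodule.span_le.2 fun u hu => hF.mono (Finset.le_sup hu) (hf u)⟩

theorem gkDim_le {d : ℕ} {C : ℝ} (hC : 1 ≤ C)
    (hup : ∀ n, (Module.finrank 𝕜 (F n) : ℝ) ≤ C * (n + 1) ^ d) : gkDim 𝕜 A ≤ d := by
  refine iSup₂_le fun W hW => ?_
  obtain ⟨N, hN⟩ := hF.exists_le_of_fg hW
  have hC' : 1 ≤ C * ((N : ℝ) + 1) ^ d :=
    one_le_mul_of_one_le_of_one_le hC (one_le_pow₀ (by simp))
  refine limsup_log_div_log_le hC' fun n hn => ?_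
  have hn' : (1 : ℝ) ≤ n := Nat.one_le_cast.2 hn
  have := Module.Finite.iff_fg.2 (hF.fg (N * n))
  calc (Module.finrank 𝕜 (⨆ i ∈ Finset.range (n + 1), W ^ i : Submodule 𝕜 A) : ℝ)
      ≤ Module.finrank 𝕜 (F (N * n)) :=
        Nat.cast_le.2 (Submodule.finrank_mono (hF.iSup_pow_le hN n))
    _ ≤ C * ((N * n : ℕ) + 1) ^ d := hup _
    _ ≤ C * ((N + 1) * n) ^ d := by
        gcongr
        push_cast
        linarith
    _ = C * (N + 1) ^ d * n ^ d := by rw [mul_pow, mul_assoc]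

end IsFiniteFiltration

theorem le_gkDim_of_le_finrank_pow {W : Submodule 𝕜 A} (hW : W.FG) {d : ℕ} {c : ℝ} (hc : 0 < c)
    (hlow : ∀ n : ℕ, c * (n : ℝ) ^ d ≤ Module.finrank 𝕜 (W ^ n : Submodule 𝕜 A)) :
    d ≤ gkDim 𝕜 A := by
  refine le_trans (le_limsup_log_div_log hc fun n => (hlow n).trans ?_)
    (le_iSup₂ (f := fun (W : Submodule 𝕜 A) (_ : W.FG) => limsup (fun n : ℕ =>
      ((Real.log (Module.finrank 𝕜 (⨆ i ∈ Finset.range (n + 1), W ^ i : Submodule 𝕜 A)) /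
        Real.log n : ℝ) : EReal)) atTop) W hW)
  have hfg : (⨆ i ∈ Finset.range (n + 1), W ^ i : Submodule 𝕜 A).FG :=
    Submodule.fg_biSup _ _ fun i _ => hW.pow i
  have := Module.Finite.iff_fg.2 hfg
  exact Nat.cast_le.2 (Submodule.finrank_mono
    (le_iSup₂ (f := fun i (_ : i ∈ Finset.range (n + 1)) => W ^ i) n (by simp)))

end GKDimension

section Straightening

variable {𝕜 A : Type*} [Field 𝕜] [Ring A] [Algebra 𝕜 A]

/-- The exponents in `E` of total degree at most `n`. -/
def expBall (E : Set (Fin 3 → ℕ)) (n : ℕ) : Set (Fin 3 → ℕ) := {e ∈ E | e 0 + e 1 + e 2 ≤ n}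

variable (𝕜) in
/-- The span of the monomials with exponents in `E` of total degree at most `n`. -/
def monoFilt (X : Fin 3 → A) (E : Set (Fin 3 → ℕ)) (n : ℕ) : Submodule 𝕜 A :=
  Submodule.span 𝕜 (mono X '' expBall E n)

variable (𝕜) in
/-- The monomials with exponents in `E` are stable under left multiplication by the generators, up
to linear combinations, compatibly with degrees. -/
structure IsStraight (X : Fin 3 → A) (E : Set (Fin 3 → ℕ)) : Prop where
  zero_mem : 0 ∈ E
  mul_mem : ∀ i, ∀ e ∈ E, X i * mono X e ∈ monoFilt 𝕜 X E (e 0 + e 1 + e 2 + 1)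

variable (𝕜) in
/-- The monomials with exponents in `E` form a basis of the algebra to which products of generators
can be straightened without raising the degree. -/
structure IsStraightBasis (X : Fin 3 → A) (E : Set (Fin 3 → ℕ)) : Prop
    extends IsStraight 𝕜 X E where
  linearIndepOn : LinearIndepOn 𝕜 (mono X) E
  span_eq_top : Submodule.span 𝕜 (mono X '' E) = ⊤

variable {X : Fin 3 → A} {E : Set (Fin 3 → ℕ)}

theorem expBall_finite (n : ℕ) : (expBall E n).Finite := by
  refine (Set.finite_Iic (fun _ : Fin 3 => n)).subset fun e he i => ?_
  have := he.2
  fin_cases i <;> simp only [Fin.zero_eta, Fin.mk_one, Fin.reduceFinMk] <;> omega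

theorem mono_mem_monoFilt {e : Fin 3 → ℕ} (he : e ∈ E) {n : ℕ} (hn : e 0 + e 1 + e 2 ≤ n) :
    mono X e ∈ monoFilt 𝕜 X E n :=
  Submodule.subset_span ⟨e, ⟨he, hn⟩, rfl⟩

theorem monoFilt_monotone : Monotone (monoFilt 𝕜 X E) := fun _ _ h =>
  Submodule.span_mono (Set.image_mono fun _ he => ⟨he.1, he.2.trans h⟩)

theorem monoFilt_le_span (n : ℕ) : monoFilt 𝕜 X E n ≤ Submodule.span 𝕜 (mono X '' E) :=
  Submodule.span_mono (Set.image_mono fun _ he => he.1)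

theorem monoFilt_fg (n : ℕ) : (monoFilt 𝕜 X E n).FG :=
  Submodule.fg_span ((expBall_finite n).image _)

theorem exists_mem_monoFilt {u : A} (hu : u ∈ Submodule.span 𝕜 (mono X '' E)) :
    ∃ n, u ∈ monoFilt 𝕜 X E n := by
  induction hu using Submodule.span_induction with
  | mem u hu => obtain ⟨e, he, rfl⟩ := hu; exact ⟨_, mono_mem_monoFilt he le_rfl⟩
  | zero => exact ⟨0, zero_mem _⟩
  | add u v _ _ hu hv =>
    obtain ⟨m, hm⟩ := hu
    obtain ⟨n, hn⟩ := hv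
    exact ⟨max m n, add_mem (monoFilt_monotone (le_max_left _ _) hm)
      (monoFilt_monotone (le_max_right _ _) hn)⟩
  | smul c u _ hu => obtain ⟨n, hn⟩ := hu; exact ⟨n, Submodule.smul_mem _ _ hn⟩

namespace IsStraight

variable (h : IsStraight 𝕜 X E)
include h

theorem one_mem : 1 ∈ monoFilt 𝕜 X E 0 := by
  simpa [mono] using mono_mem_monoFilt (𝕜 := 𝕜) (X := X) h.zero_mem (n := 0) (by simp)

theorem gen_mul_mem (i : Fin 3) {n : ℕ} {u : A} (hu : u ∈ monoFilt 𝕜 X E n) :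
    X i * u ∈ monoFilt 𝕜 X E (n + 1) := by
  refine (Submodule.span_le (p := (monoFilt 𝕜 X E (n + 1)).comap (LinearMap.mulLeft 𝕜 (X i)))).2
    ?_ hu
  rintro _ ⟨e, ⟨he, hn⟩, rfl⟩
  exact monoFilt_monotone (by omega) (h.mul_mem i e he)

theorem gen_mem (i : Fin 3) : X i ∈ monoFilt 𝕜 X E 1 := by
  simpa using h.gen_mul_mem i h.one_mem

theorem gen_pow_mul_mem (i : Fin 3) (c : ℕ) {n : ℕ} {u : A} (hu : u ∈ monoFilt 𝕜 X E n) :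
    X i ^ c * u ∈ monoFilt 𝕜 X E (c + n) := by
  induction c with
  | zero => simpa using hu
  | succ c ih =>
    rw [pow_succ', mul_assoc, show c + 1 + n = c + n + 1 by omega]
    exact h.gen_mul_mem i ih

theorem mono_mul_mem (e : Fin 3 → ℕ) {n : ℕ} {u : A} (hu : u ∈ monoFilt 𝕜 X E n) :
    mono X e * u ∈ monoFilt 𝕜 X E (e 0 + e 1 + e 2 + n) := by
  rw [mono, mul_assoc, mul_assoc, add_assoc, add_assoc]
  exact h.gen_pow_mul_mem _ _ (h.gen_pow_mul_mem _ _ (h.gen_pow_mul_mem _ _ hu))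

theorem mul_mem_monoFilt {i j : ℕ} {u v : A} (hu : u ∈ monoFilt 𝕜 X E i)
    (hv : v ∈ monoFilt 𝕜 X E j) : u * v ∈ monoFilt 𝕜 X E (i + j) := by
  refine (Submodule.span_le (p := (monoFilt 𝕜 X E (i + j)).comap (LinearMap.mulRight 𝕜 v))).2
    ?_ hu
  rintro _ ⟨e, ⟨-, hn⟩, rfl⟩
  exact monoFilt_monotone (by omega) (h.mono_mul_mem e hv)

theorem pow_mem_monoFilt {i : ℕ} {u : A} (hu : u ∈ monoFilt 𝕜 X E i) (n : ℕ) :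
    u ^ n ∈ monoFilt 𝕜 X E (n * i) := by
  induction n with
  | zero => rw [pow_zero, zero_mul]; exact h.one_mem
  | succ n ih => rw [pow_succ, add_mul, one_mul]; exact h.mul_mem_monoFilt ih hu

theorem monoFilt_le_pow (n : ℕ) : monoFilt 𝕜 X E n ≤ monoFilt 𝕜 X E 1 ^ n := by
  have hone : 1 ≤ monoFilt 𝕜 X E 1 :=
    Submodule.one_le.2 (monoFilt_monotone (Nat.zero_le 1) h.one_mem)
  refine Submodule.span_le.2 ?_
  rintro _ ⟨e, ⟨-, hn⟩, rfl⟩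
  refine pow_le_pow_right₀ hone hn ?_
  rw [pow_add, pow_add]
  exact Submodule.mul_mem_mul (Submodule.mul_mem_mul (Submodule.pow_mem_pow _ (h.gen_mem 0) _)
    (Submodule.pow_mem_pow _ (h.gen_mem 1) _)) (Submodule.pow_mem_pow _ (h.gen_mem 2) _)

end IsStraight

theorem IsStraight.span_mono_projGen_eq_top {I : TwoSidedIdeal (FreeAlgebra 𝕜 (Fin 3))}
    (h : IsStraight 𝕜 (projGen I) E) : Submodule.span 𝕜 (mono (projGen I) '' E) = ⊤ := by
  refine eq_top_iff.2 fun u _ => ?_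
  obtain ⟨y, rfl⟩ := exists_proj_eq u
  refine mem_of_mulLeft_stable
    ((Submodule.span 𝕜 (mono (projGen I) '' E)).comap (proj I).toLinearMap) ?_ ?_ y
  · simpa using monoFilt_le_span 0 h.one_mem
  · intro i y hy
    obtain ⟨n, hn⟩ := exists_mem_monoFilt hy
    simpa using monoFilt_le_span _ (h.gen_mul_mem i hn)

namespace IsStraightBasis

variable (h : IsStraightBasis 𝕜 X E)
include h

theorem isFiniteFiltration : IsFiniteFiltration (monoFilt 𝕜 X E) where
  mono := monoFilt_monotone
  one_mem := h.one_mem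
  mul_le _ _ := Submodule.mul_le.2 fun _ hu _ hv => h.mul_mem_monoFilt hu hv
  exists_mem _ := exists_mem_monoFilt (h.span_eq_top ▸ Submodule.mem_top)
  fg := monoFilt_fg

theorem finrank_monoFilt (n : ℕ) : Module.finrank 𝕜 (monoFilt 𝕜 X E n) = (expBall E n).ncard := by
  have hli : LinearIndepOn 𝕜 (mono X) (expBall E n) := h.linearIndepOn.mono fun _ he => he.1
  have := (expBall_finite (E := E) n).fintype
  rw [monoFilt, Set.image_eq_range, finrank_span_eq_card hli, Set.ncard_eq_toFinset_card',
    Set.toFinset_card]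

theorem gkDim_eq {d : ℕ} {C c : ℝ} (hC : 1 ≤ C) (hc : 0 < c)
    (hup : ∀ n, ((expBall E n).ncard : ℝ) ≤ C * (n + 1) ^ d)
    (hlow : ∀ n : ℕ, c * (n : ℝ) ^ d ≤ (expBall E n).ncard) : gkDim 𝕜 A = d := by
  refine le_antisymm (h.isFiniteFiltration.gkDim_le hC fun n => ?_)
    (le_gkDim_of_le_finrank_pow (W := monoFilt 𝕜 X E 1) (monoFilt_fg 1) hc fun n =>
      (hlow n).trans ?_)
  · rw [h.finrank_monoFilt]
    exact hup n
  · have := Module.Finite.iff_fg.2 ((monoFilt_fg (𝕜 := 𝕜) (X := X) (E := E) 1).pow n)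
    rw [← h.finrank_monoFilt]
    exact Nat.cast_le.2 (Submodule.finrank_mono (h.monoFilt_le_pow n))

end IsStraightBasis

end Straightening

section Triangular

variable {𝕜 M ι : Type*} [Field 𝕜] [AddCommGroup M] [Module 𝕜 M] {v w : ι → M} {s : Set ι}

theorem span_image_eq_of_finite (hs : s.Finite) (hw : LinearIndepOn 𝕜 w s)
    (h : ∀ e ∈ s, w e ∈ Submodule.span 𝕜 (v '' s)) :
    Submodule.span 𝕜 (w '' s) = Submodule.span 𝕜 (v '' s) := by
  have := hs.fintype
  have := FiniteDimensional.span_of_finite 𝕜 (hs.image v)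
  have hle : Submodule.span 𝕜 (w '' s) ≤ Submodule.span 𝕜 (v '' s) :=
    Submodule.span_le.2 (Set.image_subset_iff.2 h)
  refine Submodule.eq_of_le_of_finrank_le hle ?_
  rw [Set.image_eq_range, Set.image_eq_range, finrank_span_eq_card hw]
  exact finrank_range_le_card _

theorem linearIndepOn_of_finite (hs : s.Finite) (hw : LinearIndepOn 𝕜 w s)
    (h : ∀ e ∈ s, w e ∈ Submodule.span 𝕜 (v '' s)) : LinearIndepOn 𝕜 v s := by
  have := hs.fintype
  refine linearIndependent_iff_card_eq_finrank_span.2 ?_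
  rw [Set.finrank, ← Set.image_eq_range, ← span_image_eq_of_finite hs hw h, Set.image_eq_range,
    finrank_span_eq_card hw]

variable {F : ℕ → Set ι} (hF : Monotone F) (hfin : ∀ n, (F n).Finite)
  (hw : LinearIndepOn 𝕜 w (⋃ n, F n)) (h : ∀ n, ∀ e ∈ F n, w e ∈ Submodule.span 𝕜 (v '' F n))
include hfin hw h

theorem span_image_iUnion_le :
    Submodule.span 𝕜 (v '' ⋃ n, F n) ≤ Submodule.span 𝕜 (w '' ⋃ n, F n) := by
  rw [Set.image_iUnion, Submodule.span_iUnion, iSup_le_iff]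
  intro n
  rw [← span_image_eq_of_finite (hfin n) (hw.mono (Set.subset_iUnion F n)) (h n)]
  exact Submodule.span_mono (Set.image_mono (Set.subset_iUnion F n))

include hF in
theorem linearIndepOn_iUnion_of_finite : LinearIndepOn 𝕜 v (⋃ n, F n) :=
  linearIndepOn_iUnion_of_directed (hF.directed_le) fun n =>
    linearIndepOn_of_finite (hfin n) (hw.mono (Set.subset_iUnion F n)) (h n)

end Triangular

section MonomialBases

variable {𝕜 A : Type*} [Field 𝕜] [Ring A] [Algebra 𝕜 A] {X : Fin 3 → A} {E : Set (Fin 3 → ℕ)}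

theorem mono_vec (l m n : ℕ) : mono X ![l, m, n] = X 0 ^ l * X 1 ^ m * X 2 ^ n := rfl

theorem zero_mul_mono (e : Fin 3 → ℕ) : X 0 * mono X e = mono X ![e 0 + 1, e 1, e 2] := by
  rw [mono_vec, mono, pow_succ', mul_assoc, mul_assoc, mul_assoc]

namespace SatisfiesRelA

variable {p q : 𝕜} (hX : SatisfiesRelA p q X)
include hX

theorem mul_pow_zero (l : ℕ) :
    X 2 * X 0 ^ l = X 0 ^ l * X 2 - (l * q : 𝕜) • X 0 ^ (l + 1) := by
  induction l with
  | zero => simp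
  | succ l ih =>
    rw [pow_succ, ← mul_assoc, ih, sub_mul, mul_assoc, hX.mul20, mul_sub, smul_mul_assoc,
      mul_smul_comm, ← mul_assoc, ← mul_assoc, ← pow_succ, ← pow_succ]
    push_cast
    module

theorem mul_pow_one (m : ℕ) :
    X 2 * X 1 ^ m = X 1 ^ m * X 2 + (m * (p - 2 * q) : 𝕜) • (X 0 * X 1 ^ m) := by
  have hcomm (m : ℕ) : X 1 ^ m * X 0 = X 0 * X 1 ^ m := Commute.pow_left hX.mul10 m
  induction m with
  | zero => simp
  | succ m ih =>
    rw [pow_succ, ← mul_assoc, ih, add_mul, mul_assoc, hX.mul21, mul_add, smul_mul_assoc,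
      mul_smul_comm, ← mul_assoc, ← mul_assoc, hcomm]
    simp only [mul_assoc, ← pow_succ]
    push_cast
    module

theorem one_mul_mono (e : Fin 3 → ℕ) : X 1 * mono X e = mono X ![e 0, e 1 + 1, e 2] := by
  have hcomm : X 1 * X 0 ^ e 0 = X 0 ^ e 0 * X 1 := Commute.pow_right hX.mul10 _
  simp only [mono_vec]
  simp only [mono, pow_succ', mul_assoc, mul_mul_of_eq hcomm]

theorem two_mul_mono (e : Fin 3 → ℕ) : X 2 * mono X e = mono X ![e 0, e 1, e 2 + 1] +
    (e 1 * (p - 2 * q) - e 0 * q : 𝕜) • mono X ![e 0 + 1, e 1, e 2] := by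
  simp only [mono_vec]
  simp only [mono]
  rw [← mul_assoc, ← mul_assoc, hX.mul_pow_zero, sub_mul, mul_assoc (X 0 ^ e 0), hX.mul_pow_one,
    mul_add, sub_mul, add_mul, mul_smul_comm, smul_mul_assoc, smul_mul_assoc, smul_mul_assoc,
    pow_succ' (X 2), pow_succ (X 0)]
  simp only [mul_assoc]
  module

theorem isStraight : IsStraight 𝕜 X B3 := by
  refine ⟨Set.mem_univ _, fun i e _ => ?_⟩
  have hmem (l m n : ℕ) (hlmn : l + m + n ≤ e 0 + e 1 + e 2 + 1) :
      mono X ![l, m, n] ∈ monoFilt 𝕜 X B3 (e 0 + e 1 + e 2 + 1) :=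
    mono_mem_monoFilt (Set.mem_univ _) hlmn
  fin_cases i
  · exact zero_mul_mono (X := X) e ▸ hmem _ _ _ (by omega)
  · exact hX.one_mul_mono e ▸ hmem _ _ _ (by omega)
  · exact hX.two_mul_mono e ▸
      add_mem (hmem _ _ _ (by omega)) (Submodule.smul_mem _ _ (hmem _ _ _ (by omega)))

end SatisfiesRelA

namespace SatisfiesRelB

variable {p : 𝕜} (hX : SatisfiesRelB p X)
include hX

theorem zero_mul_mono {e : Fin 3 → ℕ} (he : e ∈ B1) :
    X 0 * mono X e = if e 0 = 0 then mono X ![1, e 1, e 2] else 0 := by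
  have h0 := he.1
  simp only [mono_vec]
  simp only [mono]
  interval_cases e 0 <;> simp [mul_assoc, mul_mul_of_eq hX.mul00]

theorem one_mul_mono {e : Fin 3 → ℕ} (he : e ∈ B1) :
    X 1 * mono X e = if e 1 = 0 then (-1 : 𝕜) ^ e 0 • mono X ![e 0, 1, e 2] else 0 := by
  obtain ⟨h0, h1⟩ := he
  simp only [mono_vec]
  simp only [mono]
  interval_cases e 0 <;> interval_cases e 1 <;>
    simp [mul_assoc, mul_mul_of_eq hX.mul10, mul_mul_of_eq hX.mul11]

theorem two_mul_mono {e : Fin 3 → ℕ} (he : e ∈ B1) :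
    X 2 * mono X e = (-1 : 𝕜) ^ (e 0 + e 1) • mono X ![e 0, e 1, e 2 + 1] -
      if e 0 = 0 ∧ e 1 = 1 then p • mono X ![1, 1, e 2] else 0 := by
  obtain ⟨h0, h1⟩ := he
  simp only [mono_vec]
  simp only [mono]
  interval_cases e 0 <;> interval_cases e 1 <;>
    simp [mul_assoc, pow_succ', sub_mul, mul_sub, mul_mul_of_eq hX.mul00, mul_mul_of_eq hX.mul20,
      mul_mul_of_eq hX.mul21]

theorem isStraight (hE : E ⊆ B1) (h0 : 0 ∈ E)
    (hmem : ∀ e ∈ E, ∀ l m, l < 2 → m < 2 → ![l, m, e 2] ∈ E)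
    (hnext : ∀ e ∈ E, mono X ![e 0, e 1, e 2 + 1] ∈ monoFilt 𝕜 X E (e 0 + e 1 + e 2 + 1)) :
    IsStraight 𝕜 X E := by
  refine ⟨h0, fun i e he => ?_⟩
  obtain ⟨he0, he1⟩ := hE he
  have hfilt (l m : ℕ) (hl : l < 2) (hm : m < 2) (hlm : l + m ≤ e 0 + e 1 + 1) :
      mono X ![l, m, e 2] ∈ monoFilt 𝕜 X E (e 0 + e 1 + e 2 + 1) :=
    mono_mem_monoFilt (hmem e he l m hl hm) (show l + m + e 2 ≤ _ by omega)
  fin_cases i <;> simp only [Fin.zero_eta, Fin.mk_one, Fin.reduceFinMk]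
  · rw [hX.zero_mul_mono (hE he)]
    split_ifs
    exacts [hfilt 1 _ (by omega) he1 (by omega), zero_mem _]
  · rw [hX.one_mul_mono (hE he)]
    split_ifs
    exacts [Submodule.smul_mem _ _ (hfilt _ 1 he0 (by omega) (by omega)), zero_mem _]
  · rw [hX.two_mul_mono (hE he)]
    refine sub_mem (Submodule.smul_mem _ _ (hnext e he)) ?_
    split_ifs
    exacts [Submodule.smul_mem _ _ (hfilt 1 1 (by omega) (by omega) (by omega)), zero_mem _]

theorem isStraight_B1 : IsStraight 𝕜 X B1 :=
  hX.isStraight le_rfl ⟨by simp, by simp⟩ (fun _ _ _ _ hl hm => ⟨hl, hm⟩)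
    fun e he => mono_mem_monoFilt (e := ![e 0, e 1, e 2 + 1]) he (le_of_eq rfl)

end SatisfiesRelB

theorem B0_subset_B1 : B0 ⊆ B1 := fun _ he => ⟨he 0, he 1⟩

theorem vec_mem_B0 {l m n : ℕ} (hl : l < 2) (hm : m < 2) (hn : n < 2) : ![l, m, n] ∈ B0 := by
  intro i
  fin_cases i <;> assumption

theorem SatisfiesRelC.mono_succ_mem {p k : 𝕜} (hX : SatisfiesRelC p k X) {e : Fin 3 → ℕ}
    (he : e ∈ B0) :
    mono X ![e 0, e 1, e 2 + 1] ∈ monoFilt 𝕜 X B0 (e 0 + e 1 + e 2 + 1) := by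
  obtain ⟨h0, h1, h2⟩ : e 0 < 2 ∧ e 1 < 2 ∧ e 2 < 2 := ⟨he 0, he 1, he 2⟩
  have hfilt (l m n : ℕ) (hl : l < 2) (hm : m < 2) (hn : n < 2)
      (hlmn : l + m + n ≤ e 0 + e 1 + e 2 + 1) :
      mono X ![l, m, n] ∈ monoFilt 𝕜 X B0 (e 0 + e 1 + e 2 + 1) :=
    mono_mem_monoFilt (vec_mem_B0 hl hm hn) hlmn
  rcases (by omega : e 2 = 0 ∨ e 2 = 1) with hz | hz
  · exact hfilt _ _ _ h0 h1 (by omega) (by omega)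
  have hsquare : mono X ![e 0, e 1, e 2 + 1] = if e 0 = 0 then
      if e 1 = 0 then -(k • mono X ![1, 1, 0]) - p • mono X ![1, 0, 1]
      else p • mono X ![1, 1, 1] else 0 := by
    simp only [mono_vec, hz, Nat.reduceAdd, pow_two (X 2), hX.mul22]
    interval_cases e 0 <;> interval_cases e 1 <;>
      simp [mul_sub, mul_assoc, mul_mul_of_eq hX.mul00, mul_mul_of_eq hX.mul10, hX.mul11]
  rw [hsquare]
  split_ifs
  · exact sub_mem (neg_mem (Submodule.smul_mem _ _ (hfilt _ _ _ (by simp) (by simp) (by simp)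
      (by omega)))) (Submodule.smul_mem _ _ (hfilt _ _ _ (by simp) (by simp) (by simp) (by omega)))
  · exact Submodule.smul_mem _ _ (hfilt _ _ _ (by simp) (by simp) (by simp) (by omega))
  · exact zero_mem _

theorem SatisfiesRelC.isStraight {p k : 𝕜} (hX : SatisfiesRelC p k X) : IsStraight 𝕜 X B0 :=
  hX.toSatisfiesRelB.isStraight B0_subset_B1 (fun _ => two_pos)
    (fun _ he _ _ hl hm => vec_mem_B0 hl hm (he 2)) fun _ he => hX.mono_succ_mem he

theorem IsStraight.squareMono_mem (h : IsStraight 𝕜 X E) (p k : 𝕜) (e : Fin 3 → ℕ) :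
    squareMono p k X e ∈ monoFilt 𝕜 X E (e 0 + e 1 + e 2) := by
  have hquad (i j : Fin 3) : X i * X j ∈ monoFilt 𝕜 X E 2 :=
    h.mul_mem_monoFilt (i := 1) (j := 1) (h.gen_mem i) (h.gen_mem j)
  have hsquare : squareRel p k X ∈ monoFilt 𝕜 X E 2 := by
    rw [squareRel]
    exact add_mem (add_mem (hquad _ _) (Submodule.smul_mem _ _ (hquad _ _)))
      (Submodule.smul_mem _ _ (hquad _ _))
  have hgen (i : Fin 3) (n : ℕ) : X i ^ n ∈ monoFilt 𝕜 X E n := by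
    simpa using h.pow_mem_monoFilt (h.gen_mem i) n
  rw [squareMono, show e 0 + e 1 + e 2 = e 2 / 2 * 2 + (e 0 + e 1 + e 2 % 2) by omega]
  exact h.mul_mem_monoFilt (h.pow_mem_monoFilt hsquare _)
    (h.mul_mem_monoFilt (h.mul_mem_monoFilt (hgen _ _) (hgen _ _)) (hgen _ _))

end MonomialBases

section Growth

variable {𝕜 A : Type*} [Field 𝕜] [Ring A] [Algebra 𝕜 A] {X : Fin 3 → A}

theorem expBall_ncard_le {E : Set (Fin 3 → ℕ)} {n : ℕ} {s : Finset (Fin 3 → ℕ)}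
    (hs : expBall E n ⊆ s) : (expBall E n).ncard ≤ s.card := by
  simpa using Set.ncard_le_ncard hs

theorem le_expBall_ncard {E : Set (Fin 3 → ℕ)} {n : ℕ} {s : Finset (Fin 3 → ℕ)}
    (hs : ↑s ⊆ expBall E n) : s.card ≤ (expBall E n).ncard := by
  simpa using Set.ncard_le_ncard hs (expBall_finite n)

theorem expBall_B3_ncard_le (n : ℕ) : (expBall B3 n).ncard ≤ (n + 1) ^ 3 := by
  refine (expBall_ncard_le (s := Fintype.piFinset fun _ => Finset.range (n + 1)) ?_).trans
    (by simp)
  intro e he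
  have hn := he.2
  simp only [Finset.mem_coe, Fintype.mem_piFinset, Finset.mem_range]
  intro i
  fin_cases i <;> simp only [Fin.zero_eta, Fin.mk_one, Fin.reduceFinMk] <;> omega

theorem le_expBall_B3_ncard (n : ℕ) : (n / 3 + 1) ^ 3 ≤ (expBall B3 n).ncard := by
  refine le_trans (by simp)
    (le_expBall_ncard (s := Fintype.piFinset fun _ => Finset.range (n / 3 + 1)) ?_)
  intro e he
  simp only [Finset.mem_coe, Fintype.mem_piFinset, Finset.mem_range] at he
  have h0 := he 0
  have h1 := he 1
  have h2 := he 2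
  exact ⟨Set.mem_univ _, by omega⟩

theorem expBall_B1_ncard_le (n : ℕ) : (expBall B1 n).ncard ≤ 4 * (n + 1) := by
  refine (expBall_ncard_le (s := Fintype.piFinset
    ![Finset.range 2, Finset.range 2, Finset.range (n + 1)]) ?_).trans ?_
  · rintro e ⟨⟨h0, h1⟩, hn⟩
    simp only [Finset.mem_coe, Fintype.mem_piFinset]
    intro i
    fin_cases i
    exacts [Finset.mem_range.2 h0, Finset.mem_range.2 h1,
      Finset.mem_range.2 (show e 2 < n + 1 by omega)]
  · rw [Fintype.card_piFinset, Fin.prod_univ_three]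
    simp

theorem le_expBall_B1_ncard (n : ℕ) : n + 1 ≤ (expBall B1 n).ncard := by
  have hinj : Function.Injective fun j => ![0, 0, j] := fun i j hij => congrFun hij 2
  refine le_trans (by simp [Finset.card_image_of_injective _ hinj])
    (le_expBall_ncard (s := (Finset.range (n + 1)).image fun j => ![0, 0, j]) ?_)
  intro e he
  obtain ⟨j, hj, rfl⟩ := Finset.mem_image.1 he
  rw [Finset.mem_range] at hj
  exact ⟨⟨two_pos, two_pos⟩, show 0 + 0 + j ≤ n by omega⟩

theorem B0_eq_coe_piFinset :
    B0 = (Fintype.piFinset fun _ : Fin 3 => Finset.range 2 : Finset (Fin 3 → ℕ)) := by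
  ext e
  simp [B0]

namespace IsStraightBasis

theorem gkDim_B3 (h : IsStraightBasis 𝕜 X B3) : gkDim 𝕜 A = 3 := by
  refine (h.gkDim_eq (d := 3) le_rfl (c := 1 / 27) (by norm_num) (fun n => ?_) fun n => ?_).trans
    (by norm_num)
  · rw [one_mul]
    exact_mod_cast expBall_B3_ncard_le n
  · have hn : (n : ℝ) / 3 ≤ ((n / 3 + 1 : ℕ) : ℝ) := by
      rw [div_le_iff₀ (by norm_num)]
      exact_mod_cast (by omega : n ≤ (n / 3 + 1) * 3)
    calc (1 / 27 : ℝ) * (n : ℝ) ^ 3 = ((n : ℝ) / 3) ^ 3 := by ring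
      _ ≤ ((n / 3 + 1 : ℕ) : ℝ) ^ 3 := by gcongr
      _ ≤ (expBall B3 n).ncard := by exact_mod_cast le_expBall_B3_ncard n

theorem gkDim_B1 (h : IsStraightBasis 𝕜 X B1) : gkDim 𝕜 A = 1 := by
  refine (h.gkDim_eq (d := 1) (C := 4) (by norm_num) one_pos (fun n => ?_) fun n => ?_).trans
    (by norm_num)
  · rw [pow_one]
    exact_mod_cast expBall_B1_ncard_le n
  · rw [pow_one, one_mul]
    exact_mod_cast (Nat.le_succ n).trans (le_expBall_B1_ncard n)

theorem gkDim_B0 (h : IsStraightBasis 𝕜 X B0) : gkDim 𝕜 A = 0 := by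
  have hle (n : ℕ) : (expBall B0 n).ncard ≤ 8 :=
    (expBall_ncard_le fun e he => B0_eq_coe_piFinset ▸ he.1).trans (by simp)
  have hpos (n : ℕ) : 1 ≤ (expBall B0 n).ncard :=
    (Set.ncard_pos (expBall_finite n)).2 ⟨0, h.zero_mem, Nat.zero_le n⟩
  refine (h.gkDim_eq (d := 0) (C := 8) (by norm_num) one_pos (fun n => ?_) fun n => ?_).trans
    (by norm_num)
  · rw [pow_zero, mul_one]
    exact_mod_cast hle n
  · rw [pow_zero, mul_one]
    exact_mod_cast hpos n

theorem finrank_B0 (h : IsStraightBasis 𝕜 X B0) : Module.finrank 𝕜 A = 8 := by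
  have hspan : Submodule.span 𝕜 (Set.range fun e : B0 => mono X e.1) = ⊤ := by
    rw [← Set.image_eq_range, h.span_eq_top]
  rw [Module.finrank_eq_nat_card_basis (Module.Basis.mk h.linearIndepOn hspan.ge),
    B0_eq_coe_piFinset, Nat.card_coe_set_eq, Set.ncard_coe_finset]
  simp

end IsStraightBasis

end Growth

section NicholsAlgebras

variable {𝕜 : Type*} [Field 𝕜] {a p q k : 𝕜} {E : Set (Fin 3 → ℕ)}

theorem iUnion_expBall : ⋃ n, expBall E n = E :=
  subset_antisymm (Set.iUnion_subset fun _ _ he => he.1)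
    fun _ he => Set.mem_iUnion.2 ⟨_, he, le_rfl⟩

theorem expBall_monotone : Monotone (expBall E) := fun _ _ h _ he => ⟨he.1, he.2.trans h⟩

theorem squareDegree_injOn : Set.InjOn squareDegree B1 := by
  rintro e ⟨he, -⟩ f ⟨hf, -⟩ hef
  have h0 : 2 * (e 2 / 2) + e 0 = 2 * (f 2 / 2) + f 0 := congrFun hef 0
  have h1 : e 1 = f 1 := congrFun hef 1
  have h2 : e 2 % 2 = f 2 % 2 := congrFun hef 2
  funext i
  fin_cases i <;> simp only [Fin.zero_eta, Fin.mk_one, Fin.reduceFinMk] <;> omega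

theorem IsStraightBasis.gen_of_nicholsIdeal_eq
    {r : Fin 3 → Fin 3 → Fin 3 → Fin 3 → 𝕜} {I : TwoSidedIdeal (FreeAlgebra 𝕜 (Fin 3))}
    (h : IsStraightBasis 𝕜 (projGen I) E) (hI : nicholsIdeal r = I) :
    IsStraightBasis 𝕜 (gen r) E := by
  subst hI
  exact h

theorem IsStraightBasis.isMonomialBasis {r : Fin 3 → Fin 3 → Fin 3 → Fin 3 → 𝕜}
    (h : IsStraightBasis 𝕜 (gen r) E) : IsMonomialBasis r E := by
  refine ⟨h.linearIndepOn, ?_⟩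
  rw [← h.span_eq_top, Set.image_eq_range]
  rfl

section SymmetricType

variable [CharZero 𝕜] {I : TwoSidedIdeal (FreeAlgebra 𝕜 (Fin 3))}
  (hI : IsHomogeneousHopfIdeal (c12 1 a (p - 2 * q) p q k) I)
  (hX : SatisfiesRelA p q (projGen I))
include hI hX

theorem nicholsIdeal_eq_of_satisfiesRelA : nicholsIdeal (c12 1 a (p - 2 * q) p q k) = I :=
  hI.nicholsIdeal_eq (E := B3) Subtype.val_injective
    (fun e => hI.skewDerRules.lexLowersTo_mono e)
    (by rw [← Set.image_eq_range]; exact hX.isStraight.span_mono_projGen_eq_top)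

theorem isStraightBasis_gen_of_satisfiesRelA :
    IsStraightBasis 𝕜 (gen (c12 1 a (p - 2 * q) p q k)) B3 := by
  have hli : LinearIndepOn 𝕜 (mono (projGen I)) B3 :=
    linearIndependent_of_lexLowersTo (ε := hI.counit) Subtype.val_injective
      (fun e => hI.skewDerRules.lexLowersTo_mono e) (by simp [hI.counit_one])
  exact IsStraightBasis.gen_of_nicholsIdeal_eq
    ⟨hX.isStraight, hli, hX.isStraight.span_mono_projGen_eq_top⟩
    (nicholsIdeal_eq_of_satisfiesRelA hI hX)

end SymmetricType

section ExteriorType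

variable {I : TwoSidedIdeal (FreeAlgebra 𝕜 (Fin 3))}
  (hI : IsHomogeneousHopfIdeal (c12 (-1) a (-p) p q k) I)
  (hX : SatisfiesRelB p (projGen I)) (hE : E ⊆ B1) (hs : IsStraight 𝕜 (projGen I) E)
  (hc : ∀ e ∈ E, ∀ j < 2 * (e 2 / 2) + e 0, chainCoeff (a + p ^ 2) j ≠ 0)
include hI hX hE hc

theorem linearIndepOn_squareMono : LinearIndepOn 𝕜 (squareMono p k (projGen I)) E :=
  linearIndependent_of_lexLowersTo (ε := hI.counit) (squareDegree_injOn.mono hE).injective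
    (fun e => hI.skewDerRules.lexLowersTo_squareMono hX (hE e.2) (hc e e.2))
    (by simp [hI.counit_one])

include hs

theorem nicholsIdeal_eq_of_satisfiesRelB : nicholsIdeal (c12 (-1) a (-p) p q k) = I := by
  refine hI.nicholsIdeal_eq (squareDegree_injOn.mono hE).injective
    (fun e => hI.skewDerRules.lexLowersTo_squareMono hX (hE e.2) (hc e e.2)) ?_
  have hw := linearIndepOn_squareMono hI hX hE hc
  rw [← Set.image_eq_range, eq_top_iff, ← hs.span_mono_projGen_eq_top]
  rw [← iUnion_expBall (E := E)] at hw ⊢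
  exact span_image_iUnion_le expBall_finite hw fun n e he =>
    monoFilt_monotone he.2 (hs.squareMono_mem p k e)

theorem isStraightBasis_gen_of_satisfiesRelB :
    IsStraightBasis 𝕜 (gen (c12 (-1) a (-p) p q k)) E := by
  have hli : LinearIndepOn 𝕜 (mono (projGen I)) E := by
    have hw := linearIndepOn_squareMono hI hX hE hc
    rw [← iUnion_expBall (E := E)] at hw ⊢
    exact linearIndepOn_iUnion_of_finite expBall_monotone expBall_finite hw fun n e he =>
      monoFilt_monotone he.2 (hs.squareMono_mem p k e)
  exact IsStraightBasis.gen_of_nicholsIdeal_eq ⟨hs, hli, hs.span_mono_projGen_eq_top⟩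
    (nicholsIdeal_eq_of_satisfiesRelB hI hX hE hs hc)

end ExteriorType

theorem chainCoeff_ne_zero [CharZero 𝕜] {μ : 𝕜} (hμ : μ ≠ 0) (j : ℕ) : chainCoeff μ j ≠ 0 := by
  rw [chainCoeff]
  split_ifs
  exacts [one_ne_zero, neg_ne_zero.2 (mul_ne_zero (Nat.cast_ne_zero.2 (Nat.succ_ne_zero _)) hμ)]

theorem chainCoeff_ne_zero_of_mem_B0 {e : Fin 3 → ℕ} (he : e ∈ B0) (μ : 𝕜) {j : ℕ}
    (hj : j < 2 * (e 2 / 2) + e 0) : chainCoeff μ j ≠ 0 := by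
  have h0 := he 0
  have h2 := he 2
  rw [chainCoeff, if_pos (by omega)]
  exact one_ne_zero

theorem nicholsIdeal_eq_span_relA [CharZero 𝕜] :
    nicholsIdeal (c12 1 a (p - 2 * q) p q k) = TwoSidedIdeal.span (relA p q) :=
  nicholsIdeal_eq_of_satisfiesRelA isHomogeneousHopfIdeal_span_relA
    (satisfiesRelA_projGen fun _ hg => TwoSidedIdeal.subset_span hg)

theorem isStraightBasis_gen_B3 [CharZero 𝕜] :
    IsStraightBasis 𝕜 (gen (c12 1 a (p - 2 * q) p q k)) B3 :=
  isStraightBasis_gen_of_satisfiesRelA isHomogeneousHopfIdeal_span_relA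
    (satisfiesRelA_projGen fun _ hg => TwoSidedIdeal.subset_span hg)

theorem nicholsIdeal_eq_span_relB [CharZero 𝕜] (ha : a ≠ -p ^ 2) :
    nicholsIdeal (c12 (-1) a (-p) p q k) = TwoSidedIdeal.span (relB p) :=
  have hX := satisfiesRelB_projGen fun _ hg => TwoSidedIdeal.subset_span hg
  nicholsIdeal_eq_of_satisfiesRelB (isHomogeneousHopfIdeal_span_relB ha) hX le_rfl hX.isStraight_B1
    fun _ _ j _ => chainCoeff_ne_zero (fun h => ha (eq_neg_of_add_eq_zero_left h)) j

theorem isStraightBasis_gen_B1 [CharZero 𝕜] (ha : a ≠ -p ^ 2) :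
    IsStraightBasis 𝕜 (gen (c12 (-1) a (-p) p q k)) B1 :=
  have hX := satisfiesRelB_projGen fun _ hg => TwoSidedIdeal.subset_span hg
  isStraightBasis_gen_of_satisfiesRelB (isHomogeneousHopfIdeal_span_relB ha) hX le_rfl
    hX.isStraight_B1
    fun _ _ j _ => chainCoeff_ne_zero (fun h => ha (eq_neg_of_add_eq_zero_left h)) j

theorem nicholsIdeal_eq_span_relC :
    nicholsIdeal (c12 (-1) (-p ^ 2) (-p) p q k) = TwoSidedIdeal.span (relC p k) :=
  have hX := satisfiesRelC_projGen fun _ hg => TwoSidedIdeal.subset_span hg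
  nicholsIdeal_eq_of_satisfiesRelB isHomogeneousHopfIdeal_span_relC hX.toSatisfiesRelB B0_subset_B1
    hX.isStraight fun _ he _ => chainCoeff_ne_zero_of_mem_B0 he _

theorem isStraightBasis_gen_B0 : IsStraightBasis 𝕜 (gen (c12 (-1) (-p ^ 2) (-p) p q k)) B0 :=
  have hX := satisfiesRelC_projGen fun _ hg => TwoSidedIdeal.subset_span hg
  isStraightBasis_gen_of_satisfiesRelB isHomogeneousHopfIdeal_span_relC hX.toSatisfiesRelB
    B0_subset_B1 hX.isStraight fun _ he _ => chainCoeff_ne_zero_of_mem_B0 he _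

end NicholsAlgebras

end Nichols

end

theorem proposition3p7_general {𝕜 : Type*} [Field 𝕜] (t a b p q k : 𝕜) :
    (CharZero 𝕜 → t = 1 → b = p - 2 * q →
      Nichols.nicholsIdeal (Nichols.c12 t a b p q k) = TwoSidedIdeal.span (Nichols.relA p q) ∧
      Nichols.IsMonomialBasis (Nichols.c12 t a b p q k) Nichols.B3 ∧
      Nichols.gkDim 𝕜 (Nichols.NicholsAlgebra (Nichols.c12 t a b p q k)) = 3) ∧
    (CharZero 𝕜 → t = -1 → b = -p → a ≠ -p ^ 2 →
      Nichols.nicholsIdeal (Nichols.c12 t a b p q k) = TwoSidedIdeal.span (Nichols.relB p) ∧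
      Nichols.IsMonomialBasis (Nichols.c12 t a b p q k) Nichols.B1 ∧
      Nichols.gkDim 𝕜 (Nichols.NicholsAlgebra (Nichols.c12 t a b p q k)) = 1) ∧
    (t = -1 → b = -p → a = -p ^ 2 →
      Nichols.nicholsIdeal (Nichols.c12 t a b p q k) = TwoSidedIdeal.span (Nichols.relC p k) ∧
      Nichols.IsMonomialBasis (Nichols.c12 t a b p q k) Nichols.B0 ∧
      Nichols.gkDim 𝕜 (Nichols.NicholsAlgebra (Nichols.c12 t a b p q k)) = 0 ∧
      Module.finrank 𝕜 (Nichols.NicholsAlgebra (Nichols.c12 t a b p q k)) = 8) := by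
  refine ⟨?_, ?_, ?_⟩
  · rintro _ rfl rfl
    have hB3 := Nichols.isStraightBasis_gen_B3 (a := a) (p := p) (q := q) (k := k)
    exact ⟨Nichols.nicholsIdeal_eq_span_relA, hB3.isMonomialBasis, hB3.gkDim_B3⟩
  · rintro _ rfl rfl ha
    have hB1 := Nichols.isStraightBasis_gen_B1 (q := q) (k := k) ha
    exact ⟨Nichols.nicholsIdeal_eq_span_relB ha, hB1.isMonomialBasis, hB1.gkDim_B1⟩
  · rintro rfl rfl rfl
    have hB0 := Nichols.isStraightBasis_gen_B0 (p := p) (q := q) (k := k)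
    exact ⟨Nichols.nicholsIdeal_eq_span_relC, hB0.isMonomialBasis, hB0.gkDim_B0, hB0.finrank_B0⟩

theorem proposition3p7 {𝕜 : Type*} [Field 𝕜] [IsAlgClosed 𝕜] [CharZero 𝕜]
    (t a b p q k : 𝕜) :
    (t = 1 → b = p - 2 * q →
      Nichols.nicholsIdeal (Nichols.c12 t a b p q k) = TwoSidedIdeal.span (Nichols.relA p q) ∧
      Nichols.IsMonomialBasis (Nichols.c12 t a b p q k) Nichols.B3 ∧
      Nichols.gkDim 𝕜 (Nichols.NicholsAlgebra (Nichols.c12 t a b p q k)) = 3) ∧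
    (t = -1 → b = -p → a ≠ -p ^ 2 →
      Nichols.nicholsIdeal (Nichols.c12 t a b p q k) = TwoSidedIdeal.span (Nichols.relB p) ∧
      Nichols.IsMonomialBasis (Nichols.c12 t a b p q k) Nichols.B1 ∧
      Nichols.gkDim 𝕜 (Nichols.NicholsAlgebra (Nichols.c12 t a b p q k)) = 1) ∧
    (t = -1 → b = -p → a = -p ^ 2 →
      Nichols.nicholsIdeal (Nichols.c12 t a b p q k) = TwoSidedIdeal.span (Nichols.relC p k) ∧
      Nichols.IsMonomialBasis (Nichols.c12 t a b p q k) Nichols.B0 ∧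
      Nichols.gkDim 𝕜 (Nichols.NicholsAlgebra (Nichols.c12 t a b p q k)) = 0 ∧
      Module.finrank 𝕜 (Nichols.NicholsAlgebra (Nichols.c12 t a b p q k)) = 8) := by
  have ⟨hA, hB, hC⟩ := proposition3p7_general t a b p q k
  exact ⟨hA ‹_›, hB ‹_›, hC⟩
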